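/- **Setting.** Let $u_\star\in\mathbb{R}^{n_1}$, $v_\star\in\mathbb{R}^{n_2}$ be unit vectors, $n_2\ge 3$, and let $A_i,\hat A_i\in\mathbb{R}^{n_1\times n_2}$, $i=1,\dots,m$. For a matrix $M$ let $$D(M)=u_\star u_\star^\top M v_\star v_\star^\top+(I-u_\star u_\star^\top)M(I-v_\star v_\star^\top),\qquad O(M)=u_\star u_\star^\top M(I-v_\star v_\star^\top)+(I-u_\star u_\star^\top)Mv_\star v_\star^\top .$$ Put $D_i=D(A_i)$, $O_i=O(A_i)$, $\tilde A_i=D(A_i)+O(\hat A_i)$, $\tilde O_i=O(\tilde A_i)$ and $a_i=u_\star^\top A_i v_\star$. Let $\mathcal A(X)=\big(\tfrac1{\sqrt m}\langle A_i,X\rangle_F\big)_{i\le m}$, $\tilde{\mathcal A}(X)=\big(\tfrac1{\sqrt m}\langle\tilde A_i,X\rangle_F\big)_{i\le m}$ and $y=\mathcal A(u_\star v_\star^\top)$. Given a unit vector $v_0\in\mathbb{R}^{n_2}$, the alternating least squares iterates for $\mathcal A$ are, for $t\ge0$, $$u_{t+1/2}\in\operatorname*{argmin}_u\|y-\mathcal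 A(uv_t^\top)\|^2,\quad u_{t+1}=\frac{u_{t+1/2}}{\|u_{t+1/2}\|},\quad v_{t+1/2}\in\operatorname*{argmin}_v\|y-\mathcal A(u_{t+1}v^\top)\|^2,\quad v_{t+1}=\frac{v_{t+1/2}}{\|v_{t+1/2}\|}.$$ The auxiliary iterates $\tilde u,\tilde v$ are defined in the same way with $\tilde{\mathcal A}$ in place of $\mathcal A$, with the same $y$ and $\tilde v_0=v_0$. For $x\in\mathbb{R}^{n_1}$ write $x^\parallel=\langle u_\star,x\rangle u_\star$, and for $x\in\mathbb{R}^{n_2}$ write $x^\parallel=\langle v_\star,x\rangle v_\star$; in both cases $x^\perp=x-x^\parallel$. An operator $\mathcal B$ satisfies RIP with constant $\delta$ if $(1-\delta)\|Z\|_F^2\le\|\mathcal B(Z)\|^2\le(1+\delta)\|Z\|_F^2$ for all $Z$ of rank at most $4$. Let $$T=\Big\lceil\frac{\log n_2}{4\log\log n_2}\Big\rceil,\qquad c_t=\Big(1+\frac1{\log n_2}\Big)^t-1,\qquad r=\sqrt{\frac{\log T+\log n_2}{m}} .$$ **Proposition.** For every $K>0$ there is a constant $c>0$, depending only on $K$,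 such that the following holds for all $n_1$, $n_2\ge3$, $m$ and all data as above. Suppose that 1. $\mathcal A$ and $\tilde{\mathcal A}$ satisfy RIP with constant $\delta=\frac{c}{4\log n_2}$; 2. $m\ge\delta^{-2}(n_1+n_2)(\log n_2)^2$; 3. $\frac1m\big\|\big[\sum_i a_iO_i\big]v_\star\big\|\le4\sqrt{n_1/m}$ and $\frac1m\big\|\big[\sum_i a_i\tilde O_i\big]v_\star\big\|\le4\sqrt{n_1/m}$; 4. for all $0\le t<T$, $$\tfrac1m\Big\|\Big[\sum_i a_iO_i\Big]\tilde v_t^\perp\Big\|\le Kr\|\tilde v_t^\perp\|,\qquad \tfrac1m\Big\|\Big[\sum_i a_i\tilde O_i\Big]v_t^\perp\Big\|\le Kr\max\{\|v_t^\perp\|,\|\tilde v_t^\perp\|\},$$ $$\tfrac1m\Big|\sum_i\langle O_i^\top u_\star,\tilde v_t\rangle\langle D_i,\tilde u_{t+1/2}^\perp(\tilde v_t^\perp)^\top\rangle_F\Big|\le Kr\,\big\|\mathcal A\big(\tilde u_{t+1/2}^\perp(\tilde v_t^\perp)^\top\big)\big\|,$$ $$\tfrac1m\Big|\sum_i\langle\tilde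 O_i^\top u_\star,v_t\rangle\langle D_i,u_{t+1/2}^\perp(v_t^\perp)^\top\rangle_F\Big|\le Kr\,\big\|\mathcal A\big(u_{t+1/2}^\perp(v_t^\perp)^\top\big)\big\|;$$ 5. $|\langle v_0,v_\star\rangle|\ge\frac{1}{2\sqrt{n_2\log n_2}}$; 6. the bounds in 3 and 4 also hold with the roles of rows and columns exchanged, that is, with $A_i,\tilde A_i,u_\star,v_\star,n_1$ and $(v_t,\tilde v_t,u_{t+1/2},\tilde u_{t+1/2})$ replaced by $A_i^\top,\tilde A_i^\top,v_\star,u_\star,n_2$ and $(u_{t+1},\tilde u_{t+1},v_{t+1/2},\tilde v_{t+1/2})$ (with the same $K$ and $r$, for all $0\le t<T$). Say that the first phase has ended at step $t\ge1$ if $\min\{\|v_t^\parallel\|,\|u_t^\parallel\|\}\ge\frac{c}{\log n_2}$. Then for every $0\le t\le T$ such that the first phase has not ended at any step $1\le s\le t$, $$\|v_t^\parallel\|\ge(\log n_2)^{2t}\|v_0^\parallel\|\ge\frac{(\log n_2)^{2t}}{2\sqrt{n_2\log n_2}}\qquad\text{and}\qquad\max\big\{\|v_t^\parallel-\tilde v_t^\parallel\|,\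 \|v_t^\perp-\tilde v_t^\perp\|\big\}\le c_{2t}\|v_t^\parallel\| .$$ Moreover, the first phase ends at some step $1\le t\le T$. -/

import Mathlib

namespace ALS

noncomputable section

/-- Euclidean space `ℝⁿ`. -/
abbrev Vec (n : ℕ) : Type := EuclideanSpace ℝ (Fin n)

/-- Real `a × b` matrices. -/
abbrev Mat (a b : ℕ) : Type := Matrix (Fin a) (Fin b) ℝ

/-- The matrix-vector product, with values in Euclidean space. -/
def act {a b : ℕ} (M : Mat a b) (x : Vec b) : Vec a :=
  WithLp.toLp 2 (Matrix.mulVec M x.ofLp)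

/-- The rank-one matrix `x yᵀ`. -/
def outer {a b : ℕ} (x : Vec a) (y : Vec b) : Mat a b :=
  Matrix.vecMulVec x.ofLp y.ofLp

/-- The Frobenius inner product `⟨M, X⟩ = Tr (Mᵀ X)`; the squared Frobenius norm of `Z` is
`frobInner Z Z`. -/
def frobInner {a b : ℕ} (M X : Mat a b) : ℝ :=
  (M.transpose * X).trace

/-- The measurement operator `X ↦ (m^(-1/2) ⟨A_i, X⟩)_i`. -/
def measOp {a b m : ℕ} (A : Fin m → Mat a b) (X : Mat a b) : Vec m :=
  WithLp.toLp 2 (fun i => 1 / Real.sqrt m * frobInner (A i) X)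

/-- The restricted isometry property, with constant `δ`, on all matrices of rank at most `4`. -/
def RIP {a b m : ℕ} (A : Fin m → Mat a b) (δ : ℝ) : Prop :=
  ∀ Z : Mat a b, Z.rank ≤ 4 →
    (1 - δ) * frobInner Z Z ≤ ‖measOp A Z‖ ^ 2 ∧
      ‖measOp A Z‖ ^ 2 ≤ (1 + δ) * frobInner Z Z

/-- The component of `x` along the unit vector `e`. -/
def par {n : ℕ} (e x : Vec n) : Vec n := (inner ℝ e x : ℝ) • e

/-- The component of `x` orthogonal to the unit vector `e`. -/
def perp {n : ℕ} (e x : Vec n) : Vec n := x - par e x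

/-- The block-diagonal part `D = uuᵀ M vvᵀ + (I - uuᵀ) M (I - vvᵀ)` of `M`. -/
def diagPart {a b : ℕ} (u : Vec a) (v : Vec b) (M : Mat a b) : Mat a b :=
  outer u u * M * outer v v + (1 - outer u u) * M * (1 - outer v v)

/-- The off-diagonal part `O = uuᵀ M (I - vvᵀ) + (I - uuᵀ) M vvᵀ` of `M`. -/
def offPart {a b : ℕ} (u : Vec a) (v : Vec b) (M : Mat a b) : Mat a b :=
  outer u u * M * (1 - outer v v) + (1 - outer u u) * M * outer v v

/-- The auxiliary measurement matrices: `A_i` with its off-diagonal part replaced by that of the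
matrix `Ahat_i`. For `u = e₁`, `v = e₁` this keeps the entry `(1,1)` and all entries outside of
the first row and column, and replaces the others. -/
def auxMat {a b m : ℕ} (u : Vec a) (v : Vec b) (A Ahat : Fin m → Mat a b) : Fin m → Mat a b :=
  fun i => diagPart u v (A i) + offPart u v (Ahat i)

/-- The entry `⟨u, M v⟩` of `M`; for `u = e₁`, `v = e₁` it is `M₁₁`. -/
def corner {a b : ℕ} (u : Vec a) (v : Vec b) (M : Mat a b) : ℝ :=
  inner ℝ u (act M v)

/-- `u`, `v` are the iterates of alternating least squares for the measurement matrices `A`, the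
data `y` and the initial vector `v₀`; `uh t`, `vh t` are the unnormalized iterates with index
`t + 1/2`. The value `u 0` plays no role. -/
structure IsALS {a b m : ℕ} (A : Fin m → Mat a b) (y : Vec m) (v₀ : Vec b)
    (u uh : ℕ → Vec a) (v vh : ℕ → Vec b) : Prop where
  init : v 0 = v₀
  left_argmin : ∀ t, ∀ x : Vec a,
    ‖y - measOp A (outer (uh t) (v t))‖ ^ 2 ≤ ‖y - measOp A (outer x (v t))‖ ^ 2
  left_normalize : ∀ t, u (t + 1) = ‖uh t‖⁻¹ • uh t
  right_argmin : ∀ t, ∀ x : Vec b,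
    ‖y - measOp A (outer (u (t + 1)) (vh t))‖ ^ 2 ≤ ‖y - measOp A (outer (u (t + 1)) x)‖ ^ 2
  right_normalize : ∀ t, v (t + 1) = ‖vh t‖⁻¹ • vh t

/-- The bounds on `(1/m) ∑ (A_i)₁₁ O_i` and `(1/m) ∑ (A_i)₁₁ Õ_i`, applied to the signal `vS`.
Here `B` are the auxiliary matrices. -/
structure SignalBounds {a b m : ℕ} (uS : Vec a) (vS : Vec b) (A B : Fin m → Mat a b) :
    Prop where
  orig : 1 / (m : ℝ) * ‖act (∑ i, corner uS vS (A i) • offPart uS vS (A i)) vS‖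
    ≤ 4 * Real.sqrt ((a : ℝ) / m)
  aux : 1 / (m : ℝ) * ‖act (∑ i, corner uS vS (A i) • offPart uS vS (B i)) vS‖
    ≤ 4 * Real.sqrt ((a : ℝ) / m)

/-- The near-independence bounds for one least-squares update from `v` to `uh`, and from `vaux`
to `uhaux` for the auxiliary matrices `B`, with the deviation level `r`. -/
structure UpdateBounds {a b m : ℕ} (r : ℝ) (uS : Vec a) (vS : Vec b) (A B : Fin m → Mat a b)
    (v vaux : Vec b) (uh uhaux : Vec a) : Prop where
  linear_orig :
    1 / (m : ℝ) * ‖act (∑ i, corner uS vS (A i) • offPart uS vS (A i)) (perp vS vaux)‖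
      ≤ r * ‖perp vS vaux‖
  linear_aux :
    1 / (m : ℝ) * ‖act (∑ i, corner uS vS (A i) • offPart uS vS (B i)) (perp vS v)‖
      ≤ r * max ‖perp vS v‖ ‖perp vS vaux‖
  quadratic_orig :
    1 / (m : ℝ) * |∑ i, (inner ℝ (act (offPart uS vS (A i)).transpose uS) vaux : ℝ) *
        frobInner (diagPart uS vS (A i)) (outer (perp uS uhaux) (perp vS vaux))|
      ≤ r * ‖measOp A (outer (perp uS uhaux) (perp vS vaux))‖
  quadratic_aux :
    1 / (m : ℝ) * |∑ i, (inner ℝ (act (offPart uS vS (B i)).transpose uS) v : ℝ) *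
        frobInner (diagPart uS vS (A i)) (outer (perp uS uh) (perp vS v))|
      ≤ r * ‖measOp A (outer (perp uS uh) (perp vS v))‖

/-- The number of steps `T = ⌈log n / (4 log log n)⌉`. -/
def steps (n : ℕ) : ℕ := ⌈Real.log n / (4 * Real.log (Real.log n))⌉₊

/-- The deviation level `√((log T + log η) / m)` with `T = steps n` and `η = n`. -/
def level (n m : ℕ) : ℝ := Real.sqrt ((Real.log (steps n) + Real.log n) / m)

/-- The factor `c_t = (1 + 1 / log n)^t - 1`. -/
def closeFactor (n t : ℕ) : ℝ := (1 + 1 / Real.log n) ^ t - 1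

/-- The condition that ends the first phase. -/
def PhaseOneEnds {a b : ℕ} (c : ℝ) (uS : Vec a) (vS : Vec b) (u : Vec a) (v : Vec b) : Prop :=
  c / Real.log b ≤ min ‖par vS v‖ ‖par uS u‖

end

end ALS

/-! Write `v = α e' + b` and `uh = p e + w`, where `e`, `e'` are the signal directions, `b ⟂ e'` and
`w ⟂ e`. By polarization, RIP makes the measurements of rank-one matrices preserve inner products up
to `δ`, and the normal equations then give `p = α + O(δ)` and `w = O(δ)`. In the first phase `α` may
be far smaller than `δ`, so the error in `p` has to be made proportional to `|α|`. RIP alone fails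
to do this for two correlations only, `⟨f e e', f e b⟩` and `⟨f e b, f w b⟩`.

For the auxiliary pair `(b', w')` the near-independence bounds make the same correlations at most a
small multiple of `|α|`. Replacing `(b, w)` by `(b', w')` costs `δ` times `‖b - b'‖` and `‖w - w'‖`.
The first is `O(|α|)` by induction. So is the second: the two measurement maps agree on `e ⊗ e'` and
on products of vectors orthogonal to the signal, and the normal equations tested against `w - w'`
leave only terms of size `δ ‖w - w'‖ |α|`. This is `NearIsometry.update_estimate`.

After normalization (`Close.update`) the correlation is at least `|α| / (2|α| + 3δ)`. With `L = log
n₂` this is a gain of at least `5L` while `|α| < c/L`. The relative distance `κ` of the two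
sequences becomes `κ(1 + 1/L) + 1/L`, which is the recursion of `closeFactor`, and it stays below
`1/2` for all `2T` updates. The gain brings `u_T` up to `c/L`, if the phase has not ended before.
Once a correlation is at least `c/L`, RIP alone lifts the next one above `1/2`, which ends the
phase. -/

namespace ALS

/-! ### Near-isometric bilinear maps, least-squares updates and normalization. -/

section Bilinear

variable {E F H : Type*} [NormedAddCommGroup E] [InnerProductSpace ℝ E]
  [NormedAddCommGroup F] [InnerProductSpace ℝ F] [NormedAddCommGroup H] [InnerProductSpace ℝ H]

/-- The bilinear map `f` preserves inner products of elementary tensors up to the relative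
error `δ`. -/
def NearIsometry (f : E →ₗ[ℝ] F →ₗ[ℝ] H) (δ : ℝ) : Prop :=
  ∀ x y x' y', |(inner ℝ (f x y) (f x' y') : ℝ) - inner ℝ x x' * inner ℝ y y'|
    ≤ δ * (‖x‖ * ‖y‖ * (‖x'‖ * ‖y'‖))

theorem exists_unit_smul {x : E} (hx : x ≠ 0) : ∃ z : E, ‖z‖ = 1 ∧ x = ‖x‖ • z := by
  have hx' : ‖x‖ ≠ 0 := norm_ne_zero_iff.2 hx
  exact ⟨‖x‖⁻¹ • x, by simp [norm_smul, hx'], by simp [smul_smul, hx']⟩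

/-- Polarization: norm bounds on sums of two elementary tensors give a near isometry. -/
theorem nearIsometry_of_norm_sq {f : E →ₗ[ℝ] F →ₗ[ℝ] H} {δ : ℝ}
    (h : ∀ x y x' y', |‖f x y + f x' y'‖ ^ 2 - (‖x‖ ^ 2 * ‖y‖ ^ 2 + ‖x'‖ ^ 2 * ‖y'‖ ^ 2
      + 2 * (inner ℝ x x' * inner ℝ y y' : ℝ))|
      ≤ δ * (‖x‖ ^ 2 * ‖y‖ ^ 2 + ‖x'‖ ^ 2 * ‖y'‖ ^ 2
      + 2 * (inner ℝ x x' * inner ℝ y y' : ℝ))) : NearIsometry f δ := by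
  have unit : ∀ x y x' y', ‖x‖ = 1 → ‖y‖ = 1 → ‖x'‖ = 1 → ‖y'‖ = 1 →
      |(inner ℝ (f x y) (f x' y') : ℝ) - inner ℝ x x' * inner ℝ y y'| ≤ δ := by
    intro x y x' y' hx hy hx' hy'
    have h1 := h x y x' y'
    -- The difference of the two squared norms is four times the inner product. The mixed terms in
    -- the two error bounds cancel and leave `4δ`, so polarization loses no constant.
    have h2 := h x y (-x') y'
    rw [norm_add_sq_real] at h1 h2
    simp only [map_neg, LinearMap.neg_apply, inner_neg_right, norm_neg, hx, hy, hx', hy'] at h1 h2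
    rw [abs_le] at *
    constructor <;> linarith [h1.1, h1.2, h2.1, h2.2]
  intro x y x' y'
  by_cases hx : x = 0
  · simp [hx]
  by_cases hy : y = 0
  · simp [hy]
  by_cases hx' : x' = 0
  · simp [hx']
  by_cases hy' : y' = 0
  · simp [hy']
  obtain ⟨z, hz, hxz⟩ := exists_unit_smul hx
  obtain ⟨t, ht, hyt⟩ := exists_unit_smul hy
  obtain ⟨z', hz', hxz'⟩ := exists_unit_smul hx'
  obtain ⟨t', ht', hyt'⟩ := exists_unit_smul hy'
  have key := unit z t z' t' hz ht hz' ht'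
  set a := ‖x‖
  set b := ‖y‖
  set a' := ‖x'‖
  set b' := ‖y'‖
  have hpos : 0 ≤ a * b * (a' * b') := by positivity
  rw [hxz, hyt, hxz', hyt']
  simp only [map_smul, LinearMap.smul_apply, real_inner_smul_left, real_inner_smul_right]
  calc _ = |(a * b * (a' * b')) * ((inner ℝ (f z t) (f z' t') : ℝ)
        - inner ℝ z z' * inner ℝ t t')| := by congr 1; ring
    _ = (a * b * (a' * b')) * |((inner ℝ (f z t) (f z' t') : ℝ)
        - inner ℝ z z' * inner ℝ t t')| := by rw [abs_mul, abs_of_nonneg hpos]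
    _ ≤ (a * b * (a' * b')) * δ := mul_le_mul_of_nonneg_left key hpos
    _ = _ := by ring

namespace NearIsometry

variable {f g : E →ₗ[ℝ] F →ₗ[ℝ] H} {δ : ℝ}

/-- Orthogonality in either factor removes the isometric part, and only the error `δ` survives. -/
theorem abs_inner_le_of_orthogonal (hf : NearIsometry f δ) (hδ : 0 ≤ δ) {x x' : E} {y y' : F}
    (h : (inner ℝ x x' : ℝ) = 0 ∨ (inner ℝ y y' : ℝ) = 0) {a b a' b' : ℝ}
    (hx : ‖x‖ ≤ a) (hy : ‖y‖ ≤ b) (hx' : ‖x'‖ ≤ a') (hy' : ‖y'‖ ≤ b') :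
    |(inner ℝ (f x y) (f x' y') : ℝ)| ≤ δ * (a * b * (a' * b')) := by
  have h1 := hf x y x' y'
  have h2 : (inner ℝ x x' * inner ℝ y y' : ℝ) = 0 := by rcases h with h | h <;> simp [h]
  rw [h2, sub_zero] at h1
  refine h1.trans (mul_le_mul_of_nonneg_left ?_ hδ)
  have ha := (norm_nonneg x).trans hx
  have hb := (norm_nonneg y).trans hy
  have ha' := (norm_nonneg x').trans hx'
  have hb' := (norm_nonneg y').trans hy'
  gcongr

theorem abs_inner_le (hf : NearIsometry f δ) (hδ : 0 ≤ δ) {x x' : E} {y y' : F}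
    {a b a' b' : ℝ}
    (hx : ‖x‖ ≤ a) (hy : ‖y‖ ≤ b) (hx' : ‖x'‖ ≤ a') (hy' : ‖y'‖ ≤ b') :
    |(inner ℝ (f x y) (f x' y') : ℝ)| ≤ (1 + δ) * (a * b * (a' * b')) := by
  have h1 := hf x y x' y'
  have h2 : |(inner ℝ x x' * inner ℝ y y' : ℝ)| ≤ ‖x‖ * ‖y‖ * (‖x'‖ * ‖y'‖) := by
    rw [abs_mul]
    calc _ ≤ (‖x‖ * ‖x'‖) * (‖y‖ * ‖y'‖) := by
          gcongr <;> exact abs_real_inner_le_norm _ _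
      _ = _ := by ring
  have h3 : |(inner ℝ (f x y) (f x' y') : ℝ)| ≤ (1 + δ) * (‖x‖ * ‖y‖ * (‖x'‖ * ‖y'‖)) := by
    rw [abs_le] at *
    constructor <;> linarith [h1.1, h1.2, h2.1, h2.2]
  refine h3.trans (mul_le_mul_of_nonneg_left ?_ (by linarith))
  have ha := (norm_nonneg x).trans hx
  have hb := (norm_nonneg y).trans hy
  have ha' := (norm_nonneg x').trans hx'
  have hb' := (norm_nonneg y').trans hy'
  gcongr

theorem abs_inner_self_sub_le (hf : NearIsometry f δ) (x : E) (y : F) :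
    |(inner ℝ (f x y) (f x y) : ℝ) - ‖x‖ ^ 2 * ‖y‖ ^ 2| ≤ δ * (‖x‖ ^ 2 * ‖y‖ ^ 2) := by
  have h1 := hf x y x y
  rw [real_inner_self_eq_norm_sq, real_inner_self_eq_norm_sq, real_inner_self_eq_norm_sq] at *
  convert h1 using 1
  ring

/-- The least-squares update of a near isometry is close to that of an isometry. -/
theorem norm_update_sub_le (hf : NearIsometry f δ) (hδ : 0 ≤ δ) {e uh : E} {e' v : F}
    (he : ‖e‖ = 1) (he' : ‖e'‖ = 1) (hv : ‖v‖ = 1)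
    (hn : ∀ x, (inner ℝ (f uh v - f e e') (f x v) : ℝ) = 0) :
    (1 - δ) * ‖uh - (inner ℝ e' v : ℝ) • e‖ ≤ δ := by
  set α : ℝ := inner ℝ e' v with hα
  set z := uh - α • e with hz
  have huh : uh = z + α • e := by simp [hz]
  have h1 := hn z
  have hvv : (inner ℝ v v : ℝ) = 1 := by simp [hv]
  have hee : (inner ℝ e' e' : ℝ) = 1 := by simp [he']
  -- The residual is split so that its second part has right factor orthogonal to `v`. Its
  -- correlation with `f z v` is then of order `δ`.
  have h2 : f uh v - f e e' = f z v - f e (e' - α • v) := by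
    rw [huh]; simp [map_add, map_sub]; abel
  rw [h2, inner_sub_left] at h1
  have hperp : (inner ℝ (e' - α • v) v : ℝ) = 0 := by
    rw [inner_sub_left, real_inner_smul_left, hvv, ← hα]; ring
  have hnorm : ‖e' - α • v‖ ≤ 1 := by
    have : ‖e' - α • v‖ ^ 2 ≤ 1 := by
      rw [← real_inner_self_eq_norm_sq, inner_sub_right, real_inner_smul_right, hperp,
        inner_sub_left, real_inner_smul_left, hee, real_inner_comm, ← hα]
      nlinarith [sq_nonneg α]
    nlinarith [norm_nonneg (e' - α • v)]
  have h3 := hf.abs_inner_le_of_orthogonal hδ (Or.inr hperp) he.le hnorm (le_refl ‖z‖) hv.le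
  have h4 := hf.abs_inner_self_sub_le z v
  rw [hv] at h4
  rcases (norm_nonneg z).eq_or_lt with h0 | h0
  · rw [← h0]; simpa using hδ
  · rw [abs_le] at h3 h4
    have : (1 - δ) * ‖z‖ * ‖z‖ ≤ δ * ‖z‖ := by nlinarith [h3.2, h4.1]
    exact le_of_mul_le_mul_right this h0

/-- The normal equation for the update from `α e' + b` to `p e + w`, tested against a direction
`x` orthogonal to `e`. -/
theorem abs_normal_eq_orthogonal (hf : NearIsometry f δ) (hδ : 0 ≤ δ) (hδ' : δ ≤ 1 / 100)
    {e w x : E} {e' b : F} {p α : ℝ} (he : ‖e‖ = 1) (he' : ‖e'‖ = 1) (hb : ‖b‖ ≤ 1)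
    (hv : ‖α • e' + b‖ = 1) (hw : ‖w‖ ≤ 2 * δ) (hx : (inner ℝ e x : ℝ) = 0)
    (hn : (inner ℝ (f (p • e + w) (α • e' + b) - f e e') (f x (α • e' + b)) : ℝ) = 0) :
    |(inner ℝ (f w b) (f x b) : ℝ) - inner ℝ (f e e') (f x b)| ≤ δ * ‖x‖ * (|p| + 7 * |α|) := by
  set v := α • e' + b with hvdef
  have t1 := hf.abs_inner_le_of_orthogonal hδ (Or.inl hx) he.le hv.le (le_refl ‖x‖) hv.le
  have t2 := hf.abs_inner_le_of_orthogonal hδ (Or.inl hx) he.le he'.le (le_refl ‖x‖) he'.le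
  have t3 := hf.abs_inner_le hδ hw he'.le (le_refl ‖x‖) hv.le
  have t4 := hf.abs_inner_le hδ hw hb (le_refl ‖x‖) he'.le
  have hx0 := norm_nonneg x
  have t3' : |(inner ℝ (f w e') (f x v) : ℝ)| ≤ 3 * (δ * ‖x‖) :=
    t3.trans (by linarith [mul_le_mul_of_nonneg_right hδ' (mul_nonneg hδ hx0), mul_nonneg hδ hx0])
  have t4' : |(inner ℝ (f w b) (f x e') : ℝ)| ≤ 3 * (δ * ‖x‖) :=
    t4.trans (by linarith [mul_le_mul_of_nonneg_right hδ' (mul_nonneg hδ hx0), mul_nonneg hδ hx0])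
  -- Each term on the right carries a factor `p` or `α`, and also a factor `δ`: from `e ⟂ x` in the
  -- first two, from `‖w‖ ≤ 2δ` in the others.
  have expand : (inner ℝ (f w b) (f x b) : ℝ) - inner ℝ (f e e') (f x b)
      = α * inner ℝ (f e e') (f x e') - p * inner ℝ (f e v) (f x v)
        - α * inner ℝ (f w e') (f x v) - α * inner ℝ (f w b) (f x e') := by
    have h1 : f w v = α • f w e' + f w b := by simp [hvdef]
    have h2 : f x v = α • f x e' + f x b := by simp [hvdef]
    have h3 : f (p • e + w) v - f e e' = p • f e v + (α • f w e' + f w b) - f e e' := by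
      rw [← h1]; simp
    rw [h3, inner_sub_left, inner_add_left, inner_add_left, real_inner_smul_left,
      real_inner_smul_left] at hn
    have h4 : (inner ℝ (f w b) (f x v) : ℝ)
        = α * inner ℝ (f w b) (f x e') + inner ℝ (f w b) (f x b) := by
      rw [h2, inner_add_right, real_inner_smul_right]
    have h5 : (inner ℝ (f e e') (f x v) : ℝ)
        = α * inner ℝ (f e e') (f x e') + inner ℝ (f e e') (f x b) := by
      rw [h2, inner_add_right, real_inner_smul_right]
    linarith
  have s1 : |p * (inner ℝ (f e v) (f x v) : ℝ)| ≤ |p| * (δ * ‖x‖) := by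
    rw [abs_mul]; gcongr; linarith
  have s2 : |α * (inner ℝ (f e e') (f x e') : ℝ)| ≤ |α| * (δ * ‖x‖) := by
    rw [abs_mul]; gcongr; linarith
  have s3 : |α * (inner ℝ (f w e') (f x v) : ℝ)| ≤ |α| * (3 * (δ * ‖x‖)) := by
    rw [abs_mul]; gcongr
  have s4 : |α * (inner ℝ (f w b) (f x e') : ℝ)| ≤ |α| * (3 * (δ * ‖x‖)) := by
    rw [abs_mul]; gcongr
  rw [expand, abs_le]
  rw [abs_le] at s1 s2 s3 s4
  constructor <;> linarith [s1.1, s1.2, s2.1, s2.2, s3.1, s3.2, s4.1, s4.2]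

/-- Updates with respect to two measurement maps that agree on the block-diagonal part have
orthogonal components that are close to each other. -/
theorem norm_orthogonal_sub_le (hf : NearIsometry f δ) (hg : NearIsometry g δ)
    (hδ : 0 ≤ δ) (hδ' : δ ≤ 1 / 100)
    {e w w' : E} {e' b b' : F} {p p' α α' κ : ℝ} (he : ‖e‖ = 1) (he' : ‖e'‖ = 1)
    (hfg : f e e' = g e e')
    (hfg' : ∀ x y, (inner ℝ e x : ℝ) = 0 → (inner ℝ e' y : ℝ) = 0 → f x y = g x y)
    (hw : ‖w‖ ≤ 2 * δ) (hw' : ‖w'‖ ≤ 2 * δ)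
    (hew : (inner ℝ e w : ℝ) = 0) (hew' : (inner ℝ e w' : ℝ) = 0)
    (hb : ‖b‖ ≤ 1) (hb' : ‖b'‖ ≤ 1) (hb2 : 3 / 4 ≤ ‖b‖ ^ 2)
    (heb : (inner ℝ e' b : ℝ) = 0) (heb' : (inner ℝ e' b' : ℝ) = 0)
    (hv : ‖α • e' + b‖ = 1) (hv' : ‖α' • e' + b'‖ = 1)
    (hα : |α'| ≤ 2 * |α|) (hκ : κ ≤ 1) (hbb : ‖b - b'‖ ≤ κ * |α|)
    (hn : ∀ x, (inner ℝ (f (p • e + w) (α • e' + b) - f e e') (f x (α • e' + b)) : ℝ) = 0)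
    (hn' : ∀ x, (inner ℝ (g (p' • e + w') (α' • e' + b') - f e e')
      (g x (α' • e' + b')) : ℝ) = 0) :
    ‖w - w'‖ ≤ δ * (2 * |p| + 2 * |p'| + 56 * |α|) := by
  set x := w - w' with hxdef
  have hx : (inner ℝ e x : ℝ) = 0 := by rw [hxdef, inner_sub_right, hew, hew', sub_zero]
  have hebb : (inner ℝ e' (b - b') : ℝ) = 0 := by rw [inner_sub_right, heb, heb', sub_zero]
  have hbb' : ‖b - b'‖ ≤ |α| := hbb.trans (by nlinarith [abs_nonneg α])
  have h1 := hf.abs_normal_eq_orthogonal hδ hδ' he he' hb hv hw hx (hn x)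
  have h2 := hg.abs_normal_eq_orthogonal (p := p') hδ hδ' he he' hb' hv' hw' hx
    (by rw [← hfg]; exact hn' x)
  -- All correlations left in the second normal equation involve only tensors on which `f` and `g`
  -- agree, so both equations can be compared inside `f`.
  rw [← hfg, ← hfg' w' b' hew' heb', ← hfg' x b' hx heb'] at h2
  have hx0 := norm_nonneg x
  have t1 := hf.abs_inner_le_of_orthogonal hδ (Or.inl hx) he.le he'.le (le_refl ‖x‖) hbb'
  have t2 := hf.abs_inner_le hδ hw' hbb' (le_refl ‖x‖) hb
  have t3 := hf.abs_inner_le hδ hw' hb' (le_refl ‖x‖) hbb'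
  have t4 := hf.abs_inner_self_sub_le x b
  -- The difference of the two normal equations. The left side is at least `‖x‖² / 2`; the
  -- corrections contain `b - b'`, hence a factor `|α|`.
  have expand : (inner ℝ (f x b) (f x b) : ℝ)
      = (inner ℝ (f w b) (f x b) - inner ℝ (f e e') (f x b))
        - (inner ℝ (f w' b') (f x b') - inner ℝ (f e e') (f x b'))
        + inner ℝ (f e e') (f x (b - b')) - inner ℝ (f w' (b - b')) (f x b)
        - inner ℝ (f w' b') (f x (b - b')) := by
    have e1 : f x b = f w b - f w' b := by rw [hxdef]; simp
    have e2 : (inner ℝ (f x b) (f x b) : ℝ) = inner ℝ (f w b) (f x b) - inner ℝ (f w' b) (f x b) := by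
      conv_lhs => rw [e1, ← e1]
      rw [← inner_sub_left, ← e1]
    rw [e2]
    simp only [map_sub, inner_sub_left, inner_sub_right]
    ring
  have hax : 0 ≤ δ * ‖x‖ * |α| := by positivity
  have t2' : |(inner ℝ (f w' (b - b')) (f x b) : ℝ)| ≤ 3 * (δ * ‖x‖ * |α|) :=
    t2.trans (by have := mul_le_mul_of_nonneg_right hδ' hax; linarith)
  have t3' : |(inner ℝ (f w' b') (f x (b - b')) : ℝ)| ≤ 3 * (δ * ‖x‖ * |α|) :=
    t3.trans (by have := mul_le_mul_of_nonneg_right hδ' hax; linarith)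
  have hα' : δ * ‖x‖ * |α'| ≤ 2 * (δ * ‖x‖ * |α|) := by
    have := mul_le_mul_of_nonneg_left hα (mul_nonneg hδ hx0)
    linarith
  have lower : ‖x‖ ^ 2 / 2 ≤ (inner ℝ (f x b) (f x b) : ℝ) := by
    rw [abs_le] at t4
    have : 3 / 4 * ‖x‖ ^ 2 ≤ ‖x‖ ^ 2 * ‖b‖ ^ 2 := by
      have := mul_le_mul_of_nonneg_left hb2 (sq_nonneg ‖x‖)
      linarith
    have : δ * (‖x‖ ^ 2 * ‖b‖ ^ 2) ≤ 1 / 100 * (‖x‖ ^ 2 * ‖b‖ ^ 2) := by gcongr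
    linarith [t4.1, sq_nonneg ‖x‖]
  rw [abs_le] at h1 h2 t1 t2' t3'
  have upper : ‖x‖ ^ 2 / 2 ≤ δ * ‖x‖ * (|p| + |p'| + 28 * |α|) := by
    linarith [h1.2, h2.1, t1.2, t2'.1, t3'.1]
  rcases hx0.eq_or_lt with h0 | h0
  · rw [← h0]; positivity
  · have : ‖x‖ * ‖x‖ ≤ δ * (2 * |p| + 2 * |p'| + 56 * |α|) * ‖x‖ := by
      linarith [sq ‖x‖]
    exact le_of_mul_le_mul_right this h0

/-- The coefficient of the update along `e`, given near-independence bounds for a second pair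
`(w', b')` close to `(w, b)`. -/
theorem abs_coefficient_sub_le (hf : NearIsometry f δ) (hδ : 0 ≤ δ)
    {e w w' : E} {e' b b' : F} {p α μ ρ : ℝ} (he : ‖e‖ = 1) (he' : ‖e'‖ = 1)
    (hw : ‖w‖ ≤ 1 / 4) (hw' : ‖w'‖ ≤ 1 / 4)
    (hew : (inner ℝ e w : ℝ) = 0) (hew' : (inner ℝ e w' : ℝ) = 0)
    (hb : ‖b‖ ≤ 1) (hb' : ‖b'‖ ≤ 1)
    (heb : (inner ℝ e' b : ℝ) = 0) (heb' : (inner ℝ e' b' : ℝ) = 0)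
    (hv : ‖α • e' + b‖ = 1) (hbb : ‖b - b'‖ ≤ μ)
    (hlin : |(inner ℝ (f e e') (f e b') : ℝ)| ≤ ρ)
    (hquad : |(inner ℝ (f e b') (f w' b') : ℝ)| ≤ 2 * ρ)
    (hn : ∀ x, (inner ℝ (f (p • e + w) (α • e' + b) - f e e') (f x (α • e' + b)) : ℝ) = 0) :
    |p - α| ≤ δ * (|p| + 2 * |α| + 2 * μ + ‖w - w'‖) + 3 * ρ := by
  set v := α • e' + b with hvdef
  have hn := hn e
  have hwe : (inner ℝ w e : ℝ) = 0 := by rw [real_inner_comm]; exact hew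
  have hwe' : (inner ℝ w' e : ℝ) = 0 := by rw [real_inner_comm]; exact hew'
  have hxe : (inner ℝ (w - w') e : ℝ) = 0 := by rw [inner_sub_left, hwe, hwe', sub_zero]
  have hebb : (inner ℝ e' (b - b') : ℝ) = 0 := by rw [inner_sub_right, heb, heb', sub_zero]
  have hμ : 0 ≤ μ := (norm_nonneg _).trans hbb
  have t1 := hf.abs_inner_self_sub_le e v
  have t2 := hf.abs_inner_self_sub_le e e'
  have t3 := hf.abs_inner_le_of_orthogonal hδ (Or.inr hebb) he.le he'.le he.le hbb
  have t4 := hf.abs_inner_le_of_orthogonal hδ (Or.inl hwe) hw he'.le he.le hv.le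
  have t5 := hf.abs_inner_le_of_orthogonal hδ (Or.inl hwe) hw hb he.le he'.le
  have t6 := hf.abs_inner_le_of_orthogonal hδ (Or.inl hwe) hw hb he.le hbb
  have t7 := hf.abs_inner_le_of_orthogonal hδ (Or.inl hxe) (le_refl ‖w - w'‖) hb he.le hb'
  have t8 := hf.abs_inner_le_of_orthogonal hδ (Or.inl hwe') hw' hbb he.le hb'
  rw [real_inner_comm] at hquad
  rw [he, hv] at t1
  rw [he, he'] at t2
  -- The correlations `⟨f e e', f e b'⟩` and `⟨f w' b', f e b'⟩` are controlled by `ρ`. All others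
  -- carry `δ` together with `p`, `α`, `b - b'` or `w - w'`.
  have expand : p - α
      = - (p * (inner ℝ (f e v) (f e v) - 1)) + α * (inner ℝ (f e e') (f e e') - 1)
        + inner ℝ (f e e') (f e b') + inner ℝ (f e e') (f e (b - b'))
        - α * inner ℝ (f w e') (f e v) - α * inner ℝ (f w b) (f e e')
        - inner ℝ (f w b) (f e (b - b')) - inner ℝ (f (w - w') b) (f e b')
        - inner ℝ (f w' (b - b')) (f e b') - inner ℝ (f w' b') (f e b') := by
    have h1 : f w v = α • f w e' + f w b := by simp [hvdef]
    have h2 : f e v = α • f e e' + f e b := by simp [hvdef]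
    have h3 : f (p • e + w) v - f e e' = p • f e v + (α • f w e' + f w b) - f e e' := by
      rw [← h1]; simp
    rw [h3, inner_sub_left, inner_add_left, inner_add_left, real_inner_smul_left,
      real_inner_smul_left] at hn
    have h4 : (inner ℝ (f w b) (f e v) : ℝ)
        = α * inner ℝ (f w b) (f e e') + inner ℝ (f w b) (f e b) := by
      rw [h2, inner_add_right, real_inner_smul_right]
    have h5 : (inner ℝ (f e e') (f e v) : ℝ)
        = α * inner ℝ (f e e') (f e e') + inner ℝ (f e e') (f e b) := by
      rw [h2, inner_add_right, real_inner_smul_right]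
    simp only [map_sub, LinearMap.sub_apply, inner_sub_left, inner_sub_right]
    linarith
  have s1 : |p * ((inner ℝ (f e v) (f e v) : ℝ) - 1)| ≤ |p| * δ := by
    rw [abs_mul]; gcongr; simpa using t1
  have s2 : |α * ((inner ℝ (f e e') (f e e') : ℝ) - 1)| ≤ |α| * δ := by
    rw [abs_mul]; gcongr; simpa using t2
  have s4 : |α * (inner ℝ (f w e') (f e v) : ℝ)| ≤ |α| * (δ / 4) := by
    rw [abs_mul]; gcongr; linarith
  have s5 : |α * (inner ℝ (f w b) (f e e') : ℝ)| ≤ |α| * (δ / 4) := by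
    rw [abs_mul]; gcongr; linarith
  have h0 : 0 ≤ δ * μ := by positivity
  have h0' : 0 ≤ δ * |α| := by positivity
  rw [expand, abs_le]
  rw [abs_le] at s1 s2 s4 s5 t3 t6 t7 t8 hlin hquad
  constructor
  · linarith [s1.1, s1.2, s2.1, s2.2, s4.1, s4.2, s5.1, s5.2, t3.1, t3.2, t6.1, t6.2, t7.1, t7.2,
      t8.1, t8.2, hlin.1, hlin.2, hquad.1, hquad.2]
  · linarith [s1.1, s1.2, s2.1, s2.2, s4.1, s4.2, s5.1, s5.2, t3.1, t3.2, t6.1, t6.2, t7.1, t7.2,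
      t8.1, t8.2, hlin.1, hlin.2, hquad.1, hquad.2]

end NearIsometry

/-- A vector whose norm does not decrease when multiples of `q` are added is orthogonal to `q`. -/
theorem inner_eq_zero_of_forall_norm_sq_le {z q : E} (h : ∀ t : ℝ, ‖z‖ ^ 2 ≤ ‖z - t • q‖ ^ 2) :
    (inner ℝ z q : ℝ) = 0 := by
  have h1 : ∀ t : ℝ, 0 ≤ ‖q‖ ^ 2 * (t * t) + (-2 * inner ℝ z q) * t + 0 := by
    intro t
    have h2 := h t
    rw [norm_sub_sq_real, real_inner_smul_right, norm_smul, Real.norm_eq_abs, mul_pow, sq_abs]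
      at h2
    linarith
  have h2 := discrim_le_zero h1
  unfold discrim at h2
  nlinarith [sq_nonneg (inner ℝ z q : ℝ)]

/-- Both components of the updates with respect to two measurement maps that agree on the
block-diagonal part are close to each other. -/
theorem NearIsometry.update_estimate {f g : E →ₗ[ℝ] F →ₗ[ℝ] H} {δ : ℝ} (hf : NearIsometry f δ)
    (hg : NearIsometry g δ) (hδ : 0 ≤ δ) (hδ' : δ ≤ 1 / 100)
    {e w w' : E} {e' b b' : F} {p p' α α' κ σ : ℝ} (he : ‖e‖ = 1) (he' : ‖e'‖ = 1)
    (hfg : f e e' = g e e')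
    (hfg' : ∀ x y, (inner ℝ e x : ℝ) = 0 → (inner ℝ e' y : ℝ) = 0 → f x y = g x y)
    (hw : ‖w‖ ≤ 2 * δ) (hw' : ‖w'‖ ≤ 2 * δ)
    (hew : (inner ℝ e w : ℝ) = 0) (hew' : (inner ℝ e w' : ℝ) = 0)
    (hb : ‖b‖ ≤ 1) (hb' : ‖b'‖ ≤ 1) (hb2 : 3 / 4 ≤ ‖b‖ ^ 2)
    (heb : (inner ℝ e' b : ℝ) = 0) (heb' : (inner ℝ e' b' : ℝ) = 0)
    (hv : ‖α • e' + b‖ = 1) (hv' : ‖α' • e' + b'‖ = 1)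
    (hα : |α - α'| ≤ κ * |α|) (hκ : κ ≤ 1) (hbb : ‖b - b'‖ ≤ κ * |α|) (hσ : σ ≤ 1 / 100)
    (hlin : |(inner ℝ (f e e') (f e b') : ℝ)| ≤ σ * |α|)
    (hquad : |(inner ℝ (f e b') (f w' b') : ℝ)| ≤ 2 * (σ * |α|))
    (hlin' : |(inner ℝ (g e e') (g e b) : ℝ)| ≤ σ * |α|)
    (hquad' : |(inner ℝ (g e b) (g w b) : ℝ)| ≤ 2 * (σ * |α|))
    (hn : ∀ x, (inner ℝ (f (p • e + w) (α • e' + b) - f e e') (f x (α • e' + b)) : ℝ) = 0)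
    (hn' : ∀ x, (inner ℝ (g (p' • e + w') (α' • e' + b') - f e e')
      (g x (α' • e' + b')) : ℝ) = 0) :
    ‖w - w'‖ ≤ (80 * δ + 3 * σ) * |α| ∧ |p - α| ≤ (80 * δ + 3 * σ) * |α| ∧
      |p' - α'| ≤ (80 * δ + 3 * σ) * |α| := by
  have hα0 := abs_nonneg α
  have hκα : κ * |α| ≤ |α| := by nlinarith
  have hα' : |α'| ≤ 2 * |α| := by
    have := abs_sub_abs_le_abs_sub α' α
    rw [abs_sub_comm] at this
    linarith
  have h1 := hf.norm_orthogonal_sub_le hg hδ hδ' he he' hfg hfg' hw hw' hew hew' hb hb' hb2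
    heb heb' hv hv' hα' hκ hbb hn hn'
  have h2 := hf.abs_coefficient_sub_le hδ he he' (by linarith) (by linarith) hew hew' hb hb'
    heb heb' hv hbb hlin hquad hn
  have h3 := hg.abs_coefficient_sub_le hδ he he' (by linarith) (by linarith) hew' hew hb' hb
    heb' heb hv' (norm_sub_rev b b' ▸ hbb) hlin' hquad' (by rw [← hfg]; exact hn')
  rw [norm_sub_rev w' w] at h3
  have hp := abs_sub_abs_le_abs_sub p α
  have hp' := abs_sub_abs_le_abs_sub p' α'
  set D := ‖w - w'‖ with hD
  have hD0 : 0 ≤ D := norm_nonneg _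
  have hσα : σ * |α| ≤ 1 / 100 * |α| := by gcongr
  -- A bootstrap. With `δ` replaced by `1/100` the three estimates form a linear system that bounds
  -- `|p|`, `|p'|` and `D` by multiples of `|α|`; inserting these bounds restores the factor `δ`.
  have g1 : δ * (2 * |p| + 2 * |p'| + 56 * |α|) ≤ 1 / 100 * (2 * |p| + 2 * |p'| + 56 * |α|) := by
    gcongr
  have hμ : 0 ≤ κ * |α| := (norm_nonneg _).trans hbb
  have g2 : δ * (|p| + 2 * |α| + 2 * (κ * |α|) + D)
      ≤ 1 / 100 * (|p| + 2 * |α| + 2 * (κ * |α|) + D) := by gcongr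
  have g3 : δ * (|p'| + 2 * |α'| + 2 * (κ * |α|) + D)
      ≤ 1 / 100 * (|p'| + 2 * |α'| + 2 * (κ * |α|) + D) := by gcongr
  have k1 : |p| ≤ 2 * |α| := by linarith
  have k2 : |p'| ≤ 3 * |α| := by linarith
  have k3 : D ≤ |α| := by linarith
  have l1 : δ * (2 * |p| + 2 * |p'| + 56 * |α|) ≤ δ * (66 * |α|) := by gcongr; linarith
  have l2 : δ * (|p| + 2 * |α| + 2 * (κ * |α|) + D) ≤ δ * (80 * |α|) := by gcongr; linarith
  have l3 : δ * (|p'| + 2 * |α'| + 2 * (κ * |α|) + D) ≤ δ * (80 * |α|) := by gcongr; linarith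
  have hσ0 : 0 ≤ σ * |α| := (abs_nonneg _).trans hlin
  have hδα : 0 ≤ δ * |α| := by positivity
  refine ⟨by linarith, by linarith, by linarith⟩

/-- Perturbation of the cosine `p / √(p² + W²)`, with `M² = p² + W'²` as an intermediate
hypotenuse. -/
theorem div_hypotenuse_bounds {p p' W' M N N' κ ε : ℝ} (hp : 0 < p) (hκ : 0 ≤ κ) (hκ1 : κ < 1)
    (hpp : |p' - p| ≤ κ * p) (hM0 : 0 ≤ M) (hN : 0 < N) (hN' : 0 < N')
    (hM : M ^ 2 = p ^ 2 + W' ^ 2) (hN'2 : N' ^ 2 = p' ^ 2 + W' ^ 2)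
    (hMN : (1 - ε) * N ≤ M) (hMN' : M ≤ (1 + ε) * N) :
    (1 - κ) * (p / N) ≤ (1 + ε) * (p' / N') ∧ (1 - ε) * (p' / N') ≤ (1 + κ) * (p / N) := by
  rw [abs_le] at hpp
  have hp' : 0 < p' := by nlinarith
  have hl : (1 - κ) * p ≤ p' := by linarith
  have hu : p' ≤ (1 + κ) * p := by linarith
  have hκ1' : 0 ≤ 1 - κ := by linarith
  -- `M` and `N'` share the leg `W'`, so the cosine changes by no larger a relative factor than `p`
  -- does.
  have s1 : (1 - κ) * p * N' ≤ p' * M := by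
    refine le_of_sq_le_sq ?_ (by positivity)
    rw [mul_pow _ N', mul_pow p', hN'2, hM]
    have h1 : ((1 - κ) * p) ^ 2 ≤ p' ^ 2 := by gcongr
    have h2 : ((1 - κ) * p) ^ 2 ≤ p ^ 2 := by
      gcongr; nlinarith
    nlinarith [mul_le_mul_of_nonneg_right h1 (sq_nonneg W'),
      mul_le_mul_of_nonneg_right h2 (sq_nonneg p')]
  have s2 : p' * M ≤ (1 + κ) * p * N' := by
    refine le_of_sq_le_sq ?_ (by positivity)
    rw [mul_pow p', mul_pow _ N', hN'2, hM]
    have h1 : p' ^ 2 ≤ ((1 + κ) * p) ^ 2 := by gcongr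
    have h2 : p ^ 2 ≤ ((1 + κ) * p) ^ 2 := by
      gcongr; nlinarith
    nlinarith [mul_le_mul_of_nonneg_right h1 (sq_nonneg W'),
      mul_le_mul_of_nonneg_right h2 (sq_nonneg p')]
  constructor
  · rw [← mul_div_assoc, ← mul_div_assoc, div_le_div_iff₀ hN hN']
    nlinarith [mul_le_mul_of_nonneg_left hMN' hp'.le]
  · rw [← mul_div_assoc, ← mul_div_assoc, div_le_div_iff₀ hN' hN]
    nlinarith [mul_le_mul_of_nonneg_left hMN hp'.le]

theorem norm_sq_smul_add {e w : E} (he : ‖e‖ = 1) (hew : (inner ℝ e w : ℝ) = 0) (p : ℝ) :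
    ‖p • e + w‖ ^ 2 = p ^ 2 + ‖w‖ ^ 2 := by
  rw [norm_add_sq_real, real_inner_smul_left, hew, norm_smul, he, Real.norm_eq_abs, mul_one,
    sq_abs]
  ring

theorem abs_le_norm_smul_add {e w : E} (he : ‖e‖ = 1) (hew : (inner ℝ e w : ℝ) = 0) (p : ℝ) :
    |p| ≤ ‖p • e + w‖ := by
  refine abs_le_of_sq_le_sq ?_ (norm_nonneg _)
  rw [norm_sq_smul_add he hew]
  nlinarith [sq_nonneg ‖w‖]

/-- Closeness of the components along and orthogonal to `e` survives normalization. -/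
theorem normalize_close {e w w' : E} {p p' κ ε κ' : ℝ} (he : ‖e‖ = 1)
    (hew : (inner ℝ e w : ℝ) = 0) (hew' : (inner ℝ e w' : ℝ) = 0) (hp : p ≠ 0)
    (hκ : 0 ≤ κ) (hκ1 : κ < 1) (hε1 : ε < 1) (hpp : |p' - p| ≤ κ * |p|)
    (hww : ‖w - w'‖ ≤ ε * |p|) (h1 : 1 + κ ≤ (1 - ε) * (1 + κ')) (h2 : (1 + ε) * (1 - κ') ≤ 1 - κ)
    (h3 : κ + 2 * ε ≤ κ') :
    |‖p • e + w‖⁻¹ * p - ‖p' • e + w'‖⁻¹ * p'| ≤ κ' * |‖p • e + w‖⁻¹ * p| ∧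
    ‖‖p • e + w‖⁻¹ • w - ‖p' • e + w'‖⁻¹ • w'‖ ≤ κ' * |‖p • e + w‖⁻¹ * p| := by
  wlog hpos : 0 < p generalizing p p' w w'
  · have hneg : 0 < -p := by
      rcases lt_or_gt_of_ne hp with h | h
      · linarith
      · exact absurd h hpos
    have hnn : ∀ (q : ℝ) (z : E), ‖(-q) • e + -z‖ = ‖q • e + z‖ := by
      intro q z
      rw [neg_smul, ← neg_add, norm_neg]
    have := this (w := -w) (w' := -w') (p := -p) (p' := -p') (by simp [hew]) (by simp [hew'])
      (by simpa using hp) (by rw [abs_neg, ← abs_neg]; convert hpp using 2; ring)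
      (by rw [abs_neg, neg_sub_neg, norm_sub_rev]; exact hww) hneg
    simp only [hnn] at this
    constructor
    · convert this.1 using 1
      · rw [← abs_neg]; congr 1; ring
      · rw [← abs_neg]; congr 3; ring
    · convert this.2 using 1
      · rw [← norm_neg]; congr 1; simp only [smul_neg]; abel
      · rw [← abs_neg]; congr 3; ring
  rw [abs_of_pos hpos] at hpp hww
  have hp' : 0 < p' := by
    rw [abs_le] at hpp; nlinarith
  set N := ‖p • e + w‖ with hNdef
  set N' := ‖p' • e + w'‖ with hN'def
  set M := ‖p • e + w'‖ with hMdef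
  have hpN : p ≤ N := (le_abs_self p).trans (abs_le_norm_smul_add he hew p)
  have hpN' : p' ≤ N' := (le_abs_self p').trans (abs_le_norm_smul_add he hew' p')
  have hN : 0 < N := hpos.trans_le hpN
  have hN' : 0 < N' := hp'.trans_le hpN'
  have hε : 0 ≤ ε := by
    by_contra! h
    nlinarith [norm_nonneg (w - w')]
  have hMN : |M - N| ≤ ε * N := by
    refine (abs_norm_sub_norm_le _ _).trans ?_
    have : p • e + w' - (p • e + w) = -(w - w') := by abel
    rw [this, norm_neg]
    nlinarith
  rw [abs_le] at hMN
  -- The triangle inequality, applied separately to numerator and norm, could count `κ` twice, which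
  -- would be ruinous under iteration. Comparing cosines counts it once.
  obtain ⟨hl, hu⟩ := div_hypotenuse_bounds (M := M) (ε := ε) hpos hκ hκ1 hpp (norm_nonneg _) hN hN'
    (norm_sq_smul_add he hew' p) (norm_sq_smul_add he hew' p') (by linarith) (by linarith)
  have hq : 0 < N⁻¹ * p := by positivity
  rw [abs_of_pos hq]
  rw [div_eq_inv_mul, div_eq_inv_mul] at hl hu
  constructor
  · rw [abs_le]
    constructor
    · have : (1 - ε) * (N'⁻¹ * p') ≤ (1 - ε) * ((1 + κ') * (N⁻¹ * p)) := by nlinarith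
      have := le_of_mul_le_mul_left this (by linarith)
      linarith
    · have : (1 + ε) * ((1 - κ') * (N⁻¹ * p)) ≤ (1 + ε) * (N'⁻¹ * p') := by nlinarith
      have := le_of_mul_le_mul_left this (by linarith)
      linarith
  · have hNN : |N' - N| ≤ κ * p + ε * p := by
      refine (abs_norm_sub_norm_le _ _).trans ?_
      have : p' • e + w' - (p • e + w) = (p' - p) • e - (w - w') := by
        rw [sub_smul]; abel
      rw [this]
      refine (norm_sub_le _ _).trans ?_
      rw [norm_smul, he, mul_one, Real.norm_eq_abs]
      linarith
    have hwN' : ‖w'‖ ≤ N' := by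
      refine le_of_sq_le_sq ?_ hN'.le
      rw [hN'def, norm_sq_smul_add he hew']
      nlinarith [sq_nonneg p']
    -- The first term contributes `ε`. The second contributes `κ + ε`, since `‖w'‖ ≤ N'`. This is
    -- where `κ + 2ε ≤ κ'` is needed.
    have split : N⁻¹ • w - N'⁻¹ • w' = N⁻¹ • (w - w') + (N⁻¹ * ((N' - N) * N'⁻¹)) • w' := by
      have : N⁻¹ * ((N' - N) * N'⁻¹) = N⁻¹ - N'⁻¹ := by field_simp
      rw [this, smul_sub, sub_smul]; abel
    rw [split]
    refine (norm_add_le _ _).trans ?_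
    rw [norm_smul, norm_smul, Real.norm_eq_abs, Real.norm_eq_abs, abs_mul, abs_mul,
      abs_of_pos (inv_pos.2 hN), abs_of_pos (inv_pos.2 hN')]
    have h5 : N'⁻¹ * ‖w'‖ ≤ 1 := by
      rw [inv_mul_le_iff₀ hN']; linarith
    have h6 : |N' - N| * (N'⁻¹ * ‖w'‖) ≤ |N' - N| * 1 :=
      mul_le_mul_of_nonneg_left h5 (abs_nonneg _)
    have h7 : ‖w - w'‖ + |N' - N| * (N'⁻¹ * ‖w'‖) ≤ κ' * p := by nlinarith
    calc _ = N⁻¹ * (‖w - w'‖ + |N' - N| * (N'⁻¹ * ‖w'‖)) := by ring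
      _ ≤ N⁻¹ * (κ' * p) := by gcongr
      _ = _ := by ring

end Bilinear

/-! ### Matrices acting on vectors, and the bilinear map of rank-one measurements. -/

section Act

variable {a b c m : ℕ}

theorem act_smul (M : Mat a b) (t : ℝ) (x : Vec b) : act M (t • x) = t • act M x := by
  ext i; simp [act, Matrix.mulVec_smul]

theorem act_zero (M : Mat a b) : act M 0 = 0 := by
  ext i; simp [act]

theorem add_act (M N : Mat a b) (x : Vec b) : act (M + N) x = act M x + act N x := by
  ext i; simp [act, Matrix.add_mulVec]

theorem sub_act (M N : Mat a b) (x : Vec b) : act (M - N) x = act M x - act N x := by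
  ext i; simp [act, Matrix.sub_mulVec]

theorem smul_act (t : ℝ) (M : Mat a b) (x : Vec b) : act (t • M) x = t • act M x := by
  ext i; simp [act, Matrix.smul_mulVec]

theorem sum_act {ι : Type*} (s : Finset ι) (M : ι → Mat a b) (x : Vec b) :
    act (∑ i ∈ s, M i) x = ∑ i ∈ s, act (M i) x := by
  classical
  induction s using Finset.induction_on with
  | empty => ext i; simp [act]
  | insert i s hi ih => rw [Finset.sum_insert hi, Finset.sum_insert hi, add_act, ih]

theorem one_act (x : Vec b) : act (1 : Mat b b) x = x := by
  ext i; simp [act]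

theorem mul_act (M : Mat a b) (N : Mat b c) (x : Vec c) : act (M * N) x = act M (act N x) := by
  ext i; simp [act]

theorem outer_act (x : Vec a) (y z : Vec b) : act (outer x y) z = (inner ℝ y z : ℝ) • x := by
  ext i
  simp [act, outer, Matrix.vecMulVec_mulVec, PiLp.inner_apply, dotProduct, mul_comm]

theorem inner_act_transpose (M : Mat a b) (x : Vec a) (y : Vec b) :
    (inner ℝ (act M.transpose x) y : ℝ) = inner ℝ x (act M y) := by
  simp only [act, PiLp.inner_apply, Matrix.mulVec, dotProduct, RCLike.inner_apply, conj_trivial,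
    Matrix.transpose_apply, Finset.mul_sum, Finset.sum_mul]
  rw [Finset.sum_comm]
  exact Finset.sum_congr rfl fun i _ => Finset.sum_congr rfl fun j _ => by ring

theorem frobInner_outer (M : Mat a b) (x : Vec a) (y : Vec b) :
    frobInner M (outer x y) = inner ℝ x (act M y) := by
  simp only [frobInner, outer, act, Matrix.trace, Matrix.diag, Matrix.mul_apply,
    Matrix.transpose_apply, Matrix.vecMulVec_apply, PiLp.inner_apply, Matrix.mulVec, dotProduct,
    RCLike.inner_apply, conj_trivial, Finset.sum_mul]
  rw [Finset.sum_comm]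
  exact Finset.sum_congr rfl fun i _ => Finset.sum_congr rfl fun j _ => by ring

theorem frobInner_outer_outer (x x' : Vec a) (y y' : Vec b) :
    frobInner (outer x y) (outer x' y') = (inner ℝ x x' : ℝ) * inner ℝ y y' := by
  rw [frobInner_outer, outer_act, real_inner_smul_right, real_inner_comm x x', mul_comm]

theorem frobInner_add_right (M X Y : Mat a b) :
    frobInner M (X + Y) = frobInner M X + frobInner M Y := by
  simp [frobInner, Matrix.mul_add]

theorem frobInner_comm (M X : Mat a b) : frobInner M X = frobInner X M := by
  rw [frobInner, frobInner, ← Matrix.trace_transpose, Matrix.transpose_mul,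
    Matrix.transpose_transpose]

theorem frobInner_transpose_left (M : Mat a b) (X : Mat b a) :
    frobInner M.transpose X = frobInner M X.transpose := by
  rw [frobInner, frobInner, Matrix.transpose_transpose, Matrix.trace_mul_comm,
    ← Matrix.trace_transpose, Matrix.transpose_mul]

theorem outer_transpose (x : Vec a) (y : Vec b) : (outer x y).transpose = outer y x := by
  simp [outer, Matrix.transpose_vecMulVec]

theorem outer_add_left (x x' : Vec a) (y : Vec b) :
    outer (x + x') y = outer x y + outer x' y := by
  simp [outer, Matrix.add_vecMulVec]

theorem outer_add_right (x : Vec a) (y y' : Vec b) :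
    outer x (y + y') = outer x y + outer x y' := by
  simp [outer, Matrix.vecMulVec_add]

theorem rank_outer_add_outer_le (x x' : Vec a) (y y' : Vec b) :
    (outer x y + outer x' y').rank ≤ 4 := by
  have h : outer x y + outer x' y'
      = (Matrix.of ![x.ofLp, x'.ofLp]).transpose * Matrix.of ![y.ofLp, y'.ofLp] := by
    ext i j
    simp [outer, Matrix.vecMulVec_apply, Matrix.mul_apply, Fin.sum_univ_two]
  rw [h]
  exact (Matrix.rank_mul_le_right _ _).trans ((Matrix.rank_le_height _).trans (by norm_num))

theorem measOp_transpose (A : Fin m → Mat a b) (X : Mat b a) :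
    measOp (fun i => (A i).transpose) X = measOp A X.transpose := by
  ext i; simp [measOp, frobInner_transpose_left]

theorem measOp_add (A : Fin m → Mat a b) (X Y : Mat a b) :
    measOp A (X + Y) = measOp A X + measOp A Y := by
  ext i; simp [measOp, frobInner_add_right, mul_add]

/-- The measurements of the rank-one matrices, as a bilinear map. -/
noncomputable def measBilin (A : Fin m → Mat a b) : Vec a →ₗ[ℝ] Vec b →ₗ[ℝ] Vec m :=
  LinearMap.mk₂ ℝ (fun x y => measOp A (outer x y))
    (fun x x' y => by rw [outer_add_left, measOp_add])
    (fun t x y => by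
      ext i; simp [measOp, frobInner_outer, real_inner_smul_left]; ring)
    (fun x y y' => by rw [outer_add_right, measOp_add])
    (fun t x y => by
      ext i; simp [measOp, frobInner_outer, act_smul, real_inner_smul_right]; ring)

theorem measBilin_apply (A : Fin m → Mat a b) (x : Vec a) (y : Vec b) :
    measBilin A x y = measOp A (outer x y) := rfl

theorem inner_measBilin (A : Fin m → Mat a b) (x x' : Vec a) (y y' : Vec b) :
    (inner ℝ (measBilin A x y) (measBilin A x' y') : ℝ)
      = 1 / (m : ℝ) * ∑ i, (inner ℝ x (act (A i) y) : ℝ) * inner ℝ x' (act (A i) y') := by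
  rw [measBilin_apply, measBilin_apply, PiLp.inner_apply, Finset.mul_sum]
  simp only [measOp, RCLike.inner_apply, conj_trivial, frobInner_outer]
  refine Finset.sum_congr rfl fun i _ => ?_
  have : 1 / Real.sqrt m * (1 / Real.sqrt m) = 1 / (m : ℝ) := by
    rw [div_mul_div_comm, Real.mul_self_sqrt (Nat.cast_nonneg m), one_mul]
  rw [← this]; ring

theorem RIP.transpose {A : Fin m → Mat a b} {δ : ℝ} (h : RIP A δ) :
    RIP (fun i => (A i).transpose) δ := by
  intro Z hZ
  have := h Z.transpose (by rwa [Matrix.rank_transpose])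
  rwa [← measOp_transpose, ← frobInner_transpose_left, Matrix.transpose_transpose] at this

/-- Polarization only uses sums of two rank-one matrices, which lie within the rank range of RIP. -/
theorem RIP.nearIsometry {A : Fin m → Mat a b} {δ : ℝ} (h : RIP A δ) :
    NearIsometry (measBilin A) δ := by
  refine nearIsometry_of_norm_sq fun x y x' y' => ?_
  obtain ⟨h1, h2⟩ := h _ (rank_outer_add_outer_le x x' y y')
  have h3 : frobInner (outer x y + outer x' y') (outer x y + outer x' y')
      = ‖x‖ ^ 2 * ‖y‖ ^ 2 + ‖x'‖ ^ 2 * ‖y'‖ ^ 2 + 2 * (inner ℝ x x' * inner ℝ y y' : ℝ) := by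
    rw [frobInner_add_right, frobInner_comm, frobInner_comm _ (outer x' y'),
      frobInner_add_right, frobInner_add_right]
    simp only [frobInner_outer_outer, real_inner_self_eq_norm_sq]
    rw [real_inner_comm x x', real_inner_comm y y']; ring
  rw [h3, measOp_add] at h1 h2
  rw [measBilin_apply, measBilin_apply, abs_le]
  constructor <;> linarith

end Act

/-! ### Signal and orthogonal components; block-diagonal and off-diagonal parts. -/

section Components

variable {a b m n : ℕ}

theorem inner_perp {e : Vec n} (he : ‖e‖ = 1) (x : Vec n) : (inner ℝ e (perp e x) : ℝ) = 0 := by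
  simp [perp, par, inner_sub_right, real_inner_smul_right, he]

theorem par_add_perp (e x : Vec n) : (inner ℝ e x : ℝ) • e + perp e x = x := by
  simp [perp, par]

theorem par_of_inner_eq_zero {e x : Vec n} (h : (inner ℝ e x : ℝ) = 0) : par e x = 0 := by
  simp [par, h]

theorem perp_of_inner_eq_zero {e x : Vec n} (h : (inner ℝ e x : ℝ) = 0) : perp e x = x := by
  simp [perp, par_of_inner_eq_zero h]

theorem norm_par {e : Vec n} (he : ‖e‖ = 1) (x : Vec n) : ‖par e x‖ = |(inner ℝ e x : ℝ)| := by
  simp [par, norm_smul, he]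

theorem norm_sq_eq {e : Vec n} (he : ‖e‖ = 1) (x : Vec n) :
    ‖x‖ ^ 2 = (inner ℝ e x : ℝ) ^ 2 + ‖perp e x‖ ^ 2 := by
  conv_lhs => rw [← par_add_perp e x]
  exact norm_sq_smul_add he (inner_perp he x) _

theorem norm_perp_le {e : Vec n} (he : ‖e‖ = 1) (x : Vec n) : ‖perp e x‖ ≤ ‖x‖ := by
  refine le_of_sq_le_sq ?_ (norm_nonneg _)
  rw [norm_sq_eq he x]
  nlinarith [sq_nonneg (inner ℝ e x : ℝ)]

theorem diagPart_act (u : Vec a) (v : Vec b) (M : Mat a b) (y : Vec b) :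
    act (diagPart u v M) y = par u (act M (par v y)) + perp u (act M (perp v y)) := by
  simp [diagPart, add_act, mul_act, sub_act, one_act, outer_act, perp, par]

theorem offPart_act (u : Vec a) (v : Vec b) (M : Mat a b) (y : Vec b) :
    act (offPart u v M) y = par u (act M (perp v y)) + perp u (act M (par v y)) := by
  simp [offPart, add_act, mul_act, sub_act, one_act, outer_act, perp, par]

theorem inner_diagPart_act {u : Vec a} {v : Vec b} {M : Mat a b} {x : Vec a} {y : Vec b}
    (hx : (inner ℝ u x : ℝ) = 0) (hy : (inner ℝ v y : ℝ) = 0) :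
    (inner ℝ x (act (diagPart u v M) y) : ℝ) = inner ℝ x (act M y) := by
  rw [diagPart_act, par_of_inner_eq_zero hy, perp_of_inner_eq_zero hy, act_zero]
  rw [real_inner_comm] at hx
  simp [perp, par, inner_sub_right, real_inner_smul_right, hx]

theorem corner_diagPart {u : Vec a} {v : Vec b} (hu : ‖u‖ = 1) (hv : ‖v‖ = 1) (M : Mat a b) :
    corner u v (diagPart u v M) = corner u v M := by
  have h1 : par v v = v := by simp [par, hv]
  have h2 : perp v v = 0 := by simp [perp, h1]
  rw [corner, corner, diagPart_act, h1, h2, act_zero]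
  simp [perp, par, real_inner_smul_right, hu]

theorem inner_offPart_act {u : Vec a} {v : Vec b} (hu : ‖u‖ = 1) (M : Mat a b) (y : Vec b) :
    (inner ℝ u (act (offPart u v M) y) : ℝ) = inner ℝ u (act M (perp v y)) := by
  rw [offPart_act, inner_add_right, inner_perp hu, add_zero]
  simp [par, real_inner_smul_right, hu]

theorem diagPart_transpose (u : Vec a) (v : Vec b) (M : Mat a b) :
    (diagPart u v M).transpose = diagPart v u M.transpose := by
  simp only [diagPart, Matrix.transpose_add, Matrix.transpose_mul, outer_transpose,
    Matrix.transpose_sub, Matrix.transpose_one, Matrix.mul_assoc]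

theorem outer_mul_outer {u : Vec n} (hu : ‖u‖ = 1) : outer u u * outer u u = outer u u := by
  have : u.ofLp ⬝ᵥ u.ofLp = 1 := by
    have := real_inner_self_eq_norm_sq u
    rw [hu, PiLp.inner_apply] at this
    simp only [RCLike.inner_apply, conj_trivial, one_pow] at this
    exact this
  simp [outer, Matrix.vecMulVec_mul_vecMulVec, this]

/-- Products of complementary projections vanish, so taking the block-diagonal part is idempotent
and kills off-diagonal parts. Later arguments use the construction of the auxiliary matrices only
through this identity. -/
theorem diagPart_auxMat {u : Vec a} {v : Vec b} (hu : ‖u‖ = 1) (hv : ‖v‖ = 1)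
    (A Ahat : Fin m → Mat a b) (i : Fin m) :
    diagPart u v (auxMat u v A Ahat i) = diagPart u v (A i) := by
  have hP := outer_mul_outer hu
  have hQ := outer_mul_outer hv
  unfold auxMat diagPart offPart
  set P := outer u u
  set Q := outer v v
  have hP1 : P * (1 - P) = 0 := by rw [mul_sub, hP, mul_one, sub_self]
  have hP2 : (1 - P) * P = 0 := by rw [sub_mul, hP, one_mul, sub_self]
  have hP3 : (1 - P) * (1 - P) = 1 - P := by rw [mul_sub, hP2, mul_one, sub_zero]
  have hQ1 : Q * (1 - Q) = 0 := by rw [mul_sub, hQ, mul_one, sub_self]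
  have hQ2 : (1 - Q) * Q = 0 := by rw [sub_mul, hQ, one_mul, sub_self]
  have hQ3 : (1 - Q) * (1 - Q) = 1 - Q := by rw [mul_sub, hQ2, mul_one, sub_zero]
  generalize 1 - P = P' at *
  generalize 1 - Q = Q' at *
  simp only [Matrix.mul_add, Matrix.add_mul, Matrix.mul_assoc, hQ, hQ1, hQ2, hQ3,
    Matrix.mul_zero, add_zero, zero_add]
  simp only [← Matrix.mul_assoc, hP, hP1, hP2, hP3, Matrix.zero_mul, add_zero]

end Components

/-! ### One least-squares update of the original and the auxiliary iterate. -/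

variable {a b m : ℕ}

/-- Measurement matrices with the same block-diagonal part have the same measurements of
block-diagonal rank-one matrices. -/
theorem measBilin_eq_of_diagPart_eq {uS : Vec a} {vS : Vec b} {A B : Fin m → Mat a b}
    (h : ∀ i, diagPart uS vS (B i) = diagPart uS vS (A i)) {x : Vec a} {y : Vec b}
    (hx : (inner ℝ uS x : ℝ) = 0) (hy : (inner ℝ vS y : ℝ) = 0) :
    measBilin A x y = measBilin B x y := by
  ext i
  simp only [measBilin_apply, measOp, frobInner_outer]
  rw [← inner_diagPart_act hx hy, ← h, inner_diagPart_act hx hy]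

theorem corner_eq_of_diagPart_eq {uS : Vec a} {vS : Vec b} (hu : ‖uS‖ = 1)
    (hv : ‖vS‖ = 1) {A B : Fin m → Mat a b}
    (h : ∀ i, diagPart uS vS (B i) = diagPart uS vS (A i)) (i : Fin m) :
    corner uS vS (A i) = corner uS vS (B i) := by
  rw [← corner_diagPart hu hv, ← h, corner_diagPart hu hv]

/-- The data `y` are thus also the auxiliary measurements of the signal, so the auxiliary iterates
solve a noiseless problem. -/
theorem measBilin_signal_eq_of_diagPart_eq {uS : Vec a} {vS : Vec b} (hu : ‖uS‖ = 1)
    (hv : ‖vS‖ = 1) {A B : Fin m → Mat a b}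
    (h : ∀ i, diagPart uS vS (B i) = diagPart uS vS (A i)) :
    measBilin A uS vS = measBilin B uS vS := by
  ext i
  simp only [measBilin_apply, measOp, frobInner_outer]
  change _ * corner uS vS (A i) = _ * corner uS vS (B i)
  rw [corner_eq_of_diagPart_eq hu hv h]

/-- The normal equations of the least-squares problem in the left factor. -/
theorem inner_residual_eq_zero {A : Fin m → Mat a b} {y : Vec m} {u : Vec a} {v : Vec b}
    (h : ∀ x : Vec a, ‖y - measOp A (outer u v)‖ ^ 2 ≤ ‖y - measOp A (outer x v)‖ ^ 2)
    (x : Vec a) : (inner ℝ (measBilin A u v - y) (measBilin A x v) : ℝ) = 0 := by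
  refine inner_eq_zero_of_forall_norm_sq_le fun t => ?_
  have h1 := h (u - t • x)
  rw [← measBilin_apply, ← measBilin_apply, norm_sub_rev, norm_sub_rev y] at h1
  have h2 : measBilin A (u - t • x) v - y = measBilin A u v - y - t • measBilin A x v := by
    rw [map_sub, map_smul, LinearMap.sub_apply, LinearMap.smul_apply]
    abel
  rwa [h2] at h1

/-- The bound on a linear combination of off-diagonal parts controls the correlation between the
signal and a measurement in its row. -/
theorem abs_inner_signal_le {uS : Vec a} {vS : Vec b} (hu : ‖uS‖ = 1) (hv : ‖vS‖ = 1)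
    {A B : Fin m → Mat a b} {y : Vec b} {ρ : ℝ}
    (hAB : ∀ i, diagPart uS vS (B i) = diagPart uS vS (A i))
    (h : 1 / (m : ℝ) * ‖act (∑ i, corner uS vS (A i) • offPart uS vS (B i)) (perp vS y)‖ ≤ ρ) :
    |(inner ℝ (measBilin B uS vS) (measBilin B uS (perp vS y)) : ℝ)| ≤ ρ := by
  have hm : (0 : ℝ) ≤ 1 / (m : ℝ) := by positivity
  refine le_trans ?_ h
  have hpp : perp vS (perp vS y) = perp vS y := perp_of_inner_eq_zero (inner_perp hv y)
  have hinner : (inner ℝ (measBilin B uS vS) (measBilin B uS (perp vS y)) : ℝ)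
      = 1 / (m : ℝ) * inner ℝ uS
        (act (∑ i, corner uS vS (A i) • offPart uS vS (B i)) (perp vS y)) := by
    rw [inner_measBilin, sum_act, inner_sum]
    congr 1
    refine Finset.sum_congr rfl fun i _ => ?_
    rw [smul_act, real_inner_smul_right, inner_offPart_act hu, hpp,
      corner_eq_of_diagPart_eq hu hv hAB, corner]
  rw [hinner, abs_mul, abs_of_nonneg hm]
  gcongr
  refine (abs_real_inner_le_norm _ _).trans ?_
  rw [hu, one_mul]

/-- The bound on the quadratic form in the off-diagonal and block-diagonal parts, as a correlation
of measurements. -/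
theorem abs_inner_row_le {uS : Vec a} {vS : Vec b} (hu : ‖uS‖ = 1) (hv : ‖vS‖ = 1)
    {A B : Fin m → Mat a b} {y : Vec b} {z : Vec a} {ρ : ℝ}
    (hAB : ∀ i, diagPart uS vS (B i) = diagPart uS vS (A i))
    (h : 1 / (m : ℝ) * |∑ i, (inner ℝ (act (offPart uS vS (B i)).transpose uS) y : ℝ) *
      frobInner (diagPart uS vS (A i)) (outer (perp uS z) (perp vS y))| ≤ ρ) :
    |(inner ℝ (measBilin B uS (perp vS y)) (measBilin B (perp uS z) (perp vS y)) : ℝ)| ≤ ρ := by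
  have hm : (0 : ℝ) ≤ 1 / (m : ℝ) := by positivity
  refine le_trans (le_of_eq ?_) h
  rw [inner_measBilin, abs_mul, abs_of_nonneg hm]
  congr 2
  refine Finset.sum_congr rfl fun i _ => ?_
  rw [inner_act_transpose, inner_offPart_act hu, ← hAB, frobInner_outer,
    inner_diagPart_act (inner_perp hu z) (inner_perp hv y)]

/-- Two unit vectors whose components along and orthogonal to `e` differ by at most `κ` times the
component of the first one along `e`. -/
structure Close {n : ℕ} (e x x' : Vec n) (κ : ℝ) : Prop where
  norm_left : ‖x‖ = 1
  norm_right : ‖x'‖ = 1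
  inner_sub : |(inner ℝ e x : ℝ) - inner ℝ e x'| ≤ κ * |(inner ℝ e x : ℝ)|
  perp_sub : ‖perp e x - perp e x'‖ ≤ κ * |(inner ℝ e x : ℝ)|

theorem perp_smul {n : ℕ} (e x : Vec n) (t : ℝ) : perp e (t • x) = t • perp e x := by
  simp only [perp, par, real_inner_smul_right, smul_sub, smul_smul]

theorem perp_sub_smul {n : ℕ} {e : Vec n} (he : ‖e‖ = 1) (x : Vec n) (t : ℝ) :
    perp e (x - t • e) = perp e x := by
  simp only [perp, par, inner_sub_right, real_inner_smul_right, real_inner_self_eq_norm_sq, he]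
  module

/-- The update is close to the projection of the signal, by the restricted isometry property
alone. -/
theorem RIP.norm_update_sub_le {A : Fin m → Mat a b} {δ : ℝ} (hA : RIP A δ) (hδ : 0 ≤ δ)
    (hδ' : δ ≤ 1 / 100) {uS uh : Vec a} {vS v : Vec b} (hu : ‖uS‖ = 1) (hvS : ‖vS‖ = 1)
    (hv : ‖v‖ = 1)
    (h : ∀ x : Vec a, ‖measOp A (outer uS vS) - measOp A (outer uh v)‖ ^ 2
      ≤ ‖measOp A (outer uS vS) - measOp A (outer x v)‖ ^ 2) :
    ‖uh - (inner ℝ vS v : ℝ) • uS‖ ≤ 100 / 99 * δ := by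
  have h1 := hA.nearIsometry.norm_update_sub_le hδ hu hvS hv (inner_residual_eq_zero h)
  nlinarith [norm_nonneg (uh - (inner ℝ vS v : ℝ) • uS)]

/-- One update of a vector that is sufficiently correlated with the signal is strongly correlated
with the signal. -/
theorem RIP.half_le_abs_inner {A : Fin m → Mat a b} {δ : ℝ} (hA : RIP A δ) (hδ : 0 < δ)
    (hδ' : δ ≤ 1 / 100) {uS uh : Vec a} {vS v : Vec b} (hu : ‖uS‖ = 1) (hvS : ‖vS‖ = 1)
    (hv : ‖v‖ = 1) (hα : 4 * δ ≤ |(inner ℝ vS v : ℝ)|)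
    (h : ∀ x : Vec a, ‖measOp A (outer uS vS) - measOp A (outer uh v)‖ ^ 2
      ≤ ‖measOp A (outer uS vS) - measOp A (outer x v)‖ ^ 2) :
    ‖‖uh‖⁻¹ • uh‖ = 1 ∧ 1 / 2 ≤ |(inner ℝ uS (‖uh‖⁻¹ • uh) : ℝ)| := by
  have h1 := hA.norm_update_sub_le hδ.le hδ' hu hvS hv h
  set α : ℝ := inner ℝ vS v
  set p : ℝ := inner ℝ uS uh
  have h2 : |p - α| ≤ 100 / 99 * δ := by
    have := abs_real_inner_le_norm uS (uh - α • uS)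
    rw [inner_sub_right, real_inner_smul_right, real_inner_self_eq_norm_sq, hu] at this
    refine le_trans ?_ (this.trans (by rw [one_mul]; exact h1))
    simp [p]
  have h3 : ‖perp uS uh‖ ≤ 100 / 99 * δ := by
    rw [← perp_sub_smul hu uh α]
    exact (norm_perp_le hu _).trans h1
  have h4 : ‖uh‖ ≤ |p| + ‖perp uS uh‖ := by
    conv_lhs => rw [← par_add_perp uS uh]
    refine (norm_add_le _ _).trans ?_
    rw [norm_smul, hu, mul_one, Real.norm_eq_abs]
  have h5 : |α| - |p| ≤ |p - α| := by rw [abs_sub_comm]; exact abs_sub_abs_le_abs_sub α p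
  -- The signal part thus dominates the orthogonal part, which is at most `100/99 * δ`; hence `‖uh‖
  -- ≤ 2|p|`.
  have hp : 2 * δ ≤ |p| := by linarith
  have hpN : |p| ≤ ‖uh‖ := by
    have := abs_real_inner_le_norm uS uh
    rwa [hu, one_mul] at this
  have hN : 0 < ‖uh‖ := by linarith
  refine ⟨by simp [norm_smul, hN.ne'], ?_⟩
  rw [real_inner_smul_right, abs_mul, abs_of_pos (inv_pos.2 hN), ← div_eq_inv_mul,
    le_div_iff₀ hN]
  linarith

/-- One update before normalization: the components along the signal are almost preserved, and the
orthogonal components of the original and the auxiliary update are close. -/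
theorem Close.update_estimate {A B : Fin m → Mat a b} {δ κ σ r : ℝ} (hA : RIP A δ) (hB : RIP B δ)
    (hδ : 0 ≤ δ) (hδ' : δ ≤ 1 / 100) {uS uh uhaux : Vec a} {vS v vaux : Vec b} (hu : ‖uS‖ = 1)
    (hvS : ‖vS‖ = 1) (hAB : ∀ i, diagPart uS vS (B i) = diagPart uS vS (A i))
    (hc : Close vS v vaux κ)
    (h : ∀ x : Vec a, ‖measOp A (outer uS vS) - measOp A (outer uh v)‖ ^ 2
      ≤ ‖measOp A (outer uS vS) - measOp A (outer x v)‖ ^ 2)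
    (haux : ∀ x : Vec a, ‖measOp A (outer uS vS) - measOp B (outer uhaux vaux)‖ ^ 2
      ≤ ‖measOp A (outer uS vS) - measOp B (outer x vaux)‖ ^ 2)
    (hub : UpdateBounds r uS vS A B v vaux uh uhaux)
    (hκ' : κ ≤ 1 / 2) (hα : |(inner ℝ vS v : ℝ)| ≤ 1 / 2)
    (hr0 : 0 ≤ r) (hr : r ≤ σ * |(inner ℝ vS v : ℝ)|) (hσ : σ ≤ 1 / 100) :
    ‖perp uS uh‖ ≤ 2 * δ ∧
    ‖perp uS uh - perp uS uhaux‖ ≤ (80 * δ + 3 * σ) * |(inner ℝ vS v : ℝ)| ∧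
    |(inner ℝ uS uh : ℝ) - inner ℝ vS v| ≤ (80 * δ + 3 * σ) * |(inner ℝ vS v : ℝ)| ∧
    |(inner ℝ uS uhaux : ℝ) - inner ℝ vS vaux| ≤ (80 * δ + 3 * σ) * |(inner ℝ vS v : ℝ)| := by
  have hAn := hA.nearIsometry
  have hBn := hB.nearIsometry
  have hsig := measBilin_signal_eq_of_diagPart_eq hu hvS hAB
  have hsig' : measOp A (outer uS vS) = measOp B (outer uS vS) := hsig
  have e1 := hA.norm_update_sub_le hδ hδ' hu hvS hc.norm_left h
  have e2 := hB.norm_update_sub_le (uS := uS) hδ hδ' hu hvS hc.norm_right (hsig' ▸ haux)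
  have hw : ‖perp uS uh‖ ≤ 2 * δ := by
    rw [← perp_sub_smul hu uh]; exact (norm_perp_le hu _).trans (e1.trans (by linarith))
  have hw' : ‖perp uS uhaux‖ ≤ 2 * δ := by
    rw [← perp_sub_smul hu uhaux]; exact (norm_perp_le hu _).trans (e2.trans (by linarith))
  have hb : ‖perp vS v‖ ≤ 1 := hc.norm_left ▸ norm_perp_le hvS v
  have hb' : ‖perp vS vaux‖ ≤ 1 := hc.norm_right ▸ norm_perp_le hvS vaux
  have hb2 : 3 / 4 ≤ ‖perp vS v‖ ^ 2 := by
    have := norm_sq_eq hvS v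
    rw [hc.norm_left, ← sq_abs (inner ℝ vS v : ℝ)] at this
    nlinarith [abs_nonneg (inner ℝ vS v : ℝ)]
  -- This turns the measurement norm in the quadratic bounds into the constant `2`.
  have hmeas : ∀ (x : Vec a) (y : Vec b), ‖x‖ ≤ 1 → ‖y‖ ≤ 1 →
      ‖measOp A (outer x y)‖ ≤ 2 := by
    intro x y hx hy
    have := hAn.abs_inner_le hδ hx hy hx hy
    rw [real_inner_self_eq_norm_sq, measBilin_apply, abs_of_nonneg (sq_nonneg _)] at this
    nlinarith [norm_nonneg (measOp A (outer x y))]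
  have hlin := (abs_inner_signal_le hu hvS (fun _ => rfl) hub.linear_orig).trans
    ((mul_le_of_le_one_right hr0 hb').trans hr)
  have hlin' := (abs_inner_signal_le hu hvS hAB hub.linear_aux).trans
    ((mul_le_of_le_one_right hr0 (max_le hb hb')).trans hr)
  have hquad := (abs_inner_row_le hu hvS (fun _ => rfl) hub.quadratic_orig).trans
    (mul_le_mul hr (hmeas _ _ (hw'.trans (by linarith)) hb') (norm_nonneg _) (hr0.trans hr))
  have hquad' := (abs_inner_row_le hu hvS hAB hub.quadratic_aux).trans
    (mul_le_mul hr (hmeas _ _ (hw.trans (by linarith)) hb) (norm_nonneg _) (hr0.trans hr))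
  rw [mul_comm _ (2 : ℝ)] at hquad hquad'
  refine ⟨hw, hAn.update_estimate hBn hδ hδ' hu hvS hsig
    (fun x y hx hy => measBilin_eq_of_diagPart_eq hAB hx hy) hw
    hw' (inner_perp hu _) (inner_perp hu _) hb hb' hb2 (inner_perp hvS _)
    (inner_perp hvS _) ?_ ?_ hc.inner_sub (by linarith) hc.perp_sub hσ hlin hquad hlin' hquad'
    ?_ ?_⟩
  · rw [par_add_perp, hc.norm_left]
  · rw [par_add_perp, hc.norm_right]
  · rw [par_add_perp, par_add_perp]; exact inner_residual_eq_zero h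
  · rw [par_add_perp, par_add_perp]; exact inner_residual_eq_zero haux

/-- Transfer of closeness from the coefficients before to those after an update. -/
theorem abs_sub_le_of_perturbation {p p' α α' κ ε : ℝ} (hκ : 0 ≤ κ) (hκ' : κ ≤ 1 / 2)
    (hε : 0 ≤ ε) (hε' : ε ≤ 1 / 50) (hα : |α - α'| ≤ κ * |α|) (hp : |p - α| ≤ ε * |α|)
    (hp' : |p' - α'| ≤ ε * |α|) :
    (1 - ε) * |α| ≤ |p| ∧ |p' - p| ≤ (κ + 5 * ε) * |p| := by
  have hpα : (1 - ε) * |α| ≤ |p| := by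
    have := abs_sub_abs_le_abs_sub α p
    rw [abs_sub_comm] at this
    linarith
  refine ⟨hpα, ?_⟩
  have h1 : |p' - p| ≤ |p' - α'| + |α - α'| + |p - α| := by
    have : p' - p = (p' - α') - (α - α') - (p - α) := by ring
    rw [this]
    exact (abs_sub _ _).trans (by linarith [abs_sub (p' - α') (α - α')])
  have h2 : |p' - p| ≤ (κ + 2 * ε) * |α| := by linarith
  -- The slack from `2ε` to `5ε` pays for passing from `|α|` to `|p|`.
  have h3 : κ + 2 * ε ≤ (κ + 5 * ε) * (1 - ε) := by nlinarith
  calc _ ≤ (κ + 2 * ε) * |α| := h2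
    _ ≤ (κ + 5 * ε) * (1 - ε) * |α| := by gcongr
    _ = (κ + 5 * ε) * ((1 - ε) * |α|) := by ring
    _ ≤ _ := by gcongr

/-- Normalization of two nearby updates, with closeness measured relative to the coefficient
`α` before the update. -/
theorem close_normalize {n : ℕ} {e x x' : Vec n} {α α' κ ε η : ℝ} (he : ‖e‖ = 1) (hα0 : α ≠ 0)
    (hκ : 0 ≤ κ) (hκ' : κ ≤ 1 / 2) (hε : 0 ≤ ε) (hεη : 50 * ε ≤ η) (hη : η ≤ 1)
    (hα : |α - α'| ≤ κ * |α|) (hp : |(inner ℝ e x : ℝ) - α| ≤ ε * |α|)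
    (hp' : |(inner ℝ e x' : ℝ) - α'| ≤ ε * |α|) (hw : ‖perp e x - perp e x'‖ ≤ ε * |α|) :
    Close e (‖x‖⁻¹ • x) (‖x'‖⁻¹ • x') (κ * (1 + η) + η) := by
  obtain ⟨hpα, hpp⟩ := abs_sub_le_of_perturbation hκ hκ' hε (by linarith) hα hp hp'
  have hαpos : 0 < |α| := abs_pos.2 hα0
  have hη0 : 0 ≤ η := by linarith
  have hppos : 0 < |(inner ℝ e x : ℝ)| := lt_of_lt_of_le (mul_pos (by linarith) hαpos) hpα
  have hww : ‖perp e x - perp e x'‖ ≤ 2 * ε * |(inner ℝ e x : ℝ)| := by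
    have h1 : 1 / 2 * |α| ≤ (1 - ε) * |α| := by gcongr; linarith
    have h2 : |α| ≤ 2 * |(inner ℝ e x : ℝ)| := by linarith
    calc _ ≤ ε * |α| := hw
      _ ≤ ε * (2 * |(inner ℝ e x : ℝ)|) := by gcongr
      _ = _ := by ring
  have hκη := mul_nonneg hκ hη0
  have hκε := mul_nonneg hκ hε
  have hεη2 : ε * η ≤ ε := mul_le_of_le_one_right hε hη
  have hκε2 : κ * ε ≤ ε / 2 := by nlinarith
  have hκηε : κ * η * ε ≤ ε / 2 := by nlinarith
  have fin := normalize_close (κ' := κ * (1 + η) + η) he (inner_perp he x) (inner_perp he x')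
    (abs_pos.1 hppos) (by positivity) (by linarith) (by linarith) hpp hww
    (by linarith) (by nlinarith [mul_nonneg hε hη0, mul_nonneg hκη hε]) (by linarith)
  rw [par_add_perp, par_add_perp] at fin
  have hN : 0 < ‖x‖ := by
    have := abs_real_inner_le_norm e x
    rw [he, one_mul] at this
    linarith
  have hN' : 0 < ‖x'‖ := by
    have h1 := abs_real_inner_le_norm e x'
    rw [he, one_mul] at h1
    have h2 := abs_sub_abs_le_abs_sub (inner ℝ e x : ℝ) (inner ℝ e x')
    rw [abs_sub_comm] at h2
    have h3 : (κ + 5 * ε) * |(inner ℝ e x : ℝ)| < 1 * |(inner ℝ e x : ℝ)| :=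
      mul_lt_mul_of_pos_right (by linarith) hppos
    linarith
  refine ⟨by simp [norm_smul, hN.ne'], by simp [norm_smul, hN'.ne'], ?_, ?_⟩
  · rw [real_inner_smul_right, real_inner_smul_right]; exact fin.1
  · rw [perp_smul, perp_smul, real_inner_smul_right]; exact fin.2

/-- The component along `e` of the normalization of `x`. -/
theorem abs_le_abs_inner_normalize_mul {n : ℕ} {e x : Vec n} {α δ : ℝ} (he : ‖e‖ = 1)
    (hα0 : α ≠ 0) (hp : |(inner ℝ e x : ℝ) - α| ≤ 1 / 4 * |α|) (hw : ‖perp e x‖ ≤ 2 * δ) :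
    |α| ≤ |(inner ℝ e (‖x‖⁻¹ • x) : ℝ)| * (2 * |α| + 3 * δ) := by
  have hαpos : 0 < |α| := abs_pos.2 hα0
  have hδ : 0 ≤ δ := by linarith [norm_nonneg (perp e x)]
  set p : ℝ := inner ℝ e x with hpdef
  have h1 := abs_sub_abs_le_abs_sub p α
  have h2 := abs_sub_abs_le_abs_sub α p
  rw [abs_sub_comm] at h2
  have hpN : |p| ≤ ‖x‖ := by
    have := abs_real_inner_le_norm e x
    rwa [he, one_mul] at this
  have hN : 0 < ‖x‖ := by linarith
  have h4 : ‖x‖ ≤ |p| + ‖perp e x‖ := by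
    conv_lhs => rw [← par_add_perp e x]
    refine (norm_add_le _ _).trans ?_
    rw [norm_smul, he, mul_one, Real.norm_eq_abs]
  have h6 : 3 / 4 * |α| ≤ |p| := by linarith
  rw [real_inner_smul_right, abs_mul, abs_of_pos (inv_pos.2 hN), ← hpdef, mul_assoc,
    ← div_eq_inv_mul, le_div_iff₀ hN]
  -- The constants `2` and `3` in the claim satisfy `3/4 * 2 ≥ 5/4` and `3/4 * 3 ≥ 2`.
  calc |α| * ‖x‖ ≤ |α| * (5 / 4 * |α| + 2 * δ) := by gcongr; linarith
    _ ≤ 3 / 4 * |α| * (2 * |α| + 3 * δ) := by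
      nlinarith [mul_nonneg hαpos.le hδ, mul_nonneg hαpos.le hαpos.le]
    _ ≤ _ := by gcongr

/-- One update keeps the original and the auxiliary iterate close and amplifies the component
along the signal. -/
theorem Close.update {A B : Fin m → Mat a b} {δ κ σ η r : ℝ} (hA : RIP A δ) (hB : RIP B δ)
    (hδ : 0 ≤ δ) (hδ' : δ ≤ 1 / 100) {uS uh uhaux : Vec a} {vS v vaux : Vec b} (hu : ‖uS‖ = 1)
    (hvS : ‖vS‖ = 1) (hAB : ∀ i, diagPart uS vS (B i) = diagPart uS vS (A i))
    (hc : Close vS v vaux κ)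
    (h : ∀ x : Vec a, ‖measOp A (outer uS vS) - measOp A (outer uh v)‖ ^ 2
      ≤ ‖measOp A (outer uS vS) - measOp A (outer x v)‖ ^ 2)
    (haux : ∀ x : Vec a, ‖measOp A (outer uS vS) - measOp B (outer uhaux vaux)‖ ^ 2
      ≤ ‖measOp A (outer uS vS) - measOp B (outer x vaux)‖ ^ 2)
    (hub : UpdateBounds r uS vS A B v vaux uh uhaux)
    (hκ : 0 ≤ κ) (hκ' : κ ≤ 1 / 2) (hα : |(inner ℝ vS v : ℝ)| ≤ 1 / 2)
    (hα0 : (inner ℝ vS v : ℝ) ≠ 0) (hr0 : 0 ≤ r) (hr : r ≤ σ * |(inner ℝ vS v : ℝ)|)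
    (hη : η ≤ 1) (hση : 50 * (80 * δ + 3 * σ) ≤ η) :
    Close uS (‖uh‖⁻¹ • uh) (‖uhaux‖⁻¹ • uhaux) (κ * (1 + η) + η) ∧
      |(inner ℝ vS v : ℝ)| ≤ |(inner ℝ uS (‖uh‖⁻¹ • uh) : ℝ)| *
        (2 * |(inner ℝ vS v : ℝ)| + 3 * δ) := by
  have hσ0 : 0 ≤ σ := nonneg_of_mul_nonneg_left (hr0.trans hr) (abs_pos.2 hα0)
  obtain ⟨k0, k1, k2, k3⟩ := hc.update_estimate hA hB hδ hδ' hu hvS hAB h haux hub hκ' hα hr0 hr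
    (by linarith)
  refine ⟨close_normalize hu hα0 hκ hκ' (by positivity) hση hη hc.inner_sub k2 k3 k1,
    abs_le_abs_inner_normalize_mul hu hα0 (k2.trans ?_) k0⟩
  gcongr
  linarith

/-! ### Numerical bounds: dimension, number of steps, deviation level, growth. -/

theorem exp_neg_twentyone_le : Real.exp (-21) ≤ 1 / 1000 := by
  have h : (2 : ℝ) ^ 21 ≤ Real.exp 1 ^ 21 := by
    gcongr
    linarith [Real.add_one_le_exp (1 : ℝ)]
  rw [← Real.exp_nat_mul] at h
  rw [Real.exp_neg, inv_eq_one_div]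
  apply one_div_le_one_div_of_le (by norm_num)
  norm_num at h
  linarith

theorem one_lt_log {n : ℕ} (hn : 3 ≤ n) : 1 < Real.log n := by
  have h3 : (3 : ℝ) ≤ n := by exact_mod_cast hn
  rw [Real.lt_log_iff_exp_lt (by linarith)]
  linarith [Real.exp_one_lt_d9]

theorem steps_pos {n : ℕ} (hn : 3 ≤ n) : 0 < steps n := by
  have hL := one_lt_log hn
  have := Real.log_pos hL
  exact Nat.ceil_pos.2 (by positivity)

theorem le_steps (n : ℕ) : Real.log n / (4 * Real.log (Real.log n)) ≤ steps n := Nat.le_ceil _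

/-- A tiny correlation that still satisfies the lower bound at initialization forces the
dimension to be large. -/
theorem forty_le_log {n : ℕ} {α c : ℝ} (hn : 3 ≤ n) (hc : 0 < c) (hc' : c ≤ Real.exp (-21))
    (h1 : 1 / (2 * Real.sqrt (n * Real.log n)) ≤ α) (h2 : α < c / Real.log n) :
    40 ≤ Real.log n := by
  by_contra! hlt
  have hL := one_lt_log hn
  have hn0 : (0 : ℝ) < n := by exact_mod_cast (by omega : 0 < n)
  have hs : 0 < Real.sqrt (n * Real.log n) := Real.sqrt_pos.2 (by positivity)
  have h3 := h1.trans_lt h2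
  rw [div_lt_div_iff₀ (by positivity) (by linarith), one_mul] at h3
  -- Squaring gives `log n < 4c²n`. If `n ≤ e⁴⁰`, the right side is at most `4e⁻² ≤ 1`, because `c ≤
  -- e⁻²¹`.
  have h4 : Real.log n ^ 2 < (c * (2 * Real.sqrt (n * Real.log n))) ^ 2 := by gcongr
  rw [mul_pow, mul_pow, Real.sq_sqrt (by positivity)] at h4
  have h5 : Real.log n < 4 * (c ^ 2 * n) := by
    have : Real.log n * Real.log n < 4 * (c ^ 2 * n) * Real.log n := by linarith
    exact lt_of_mul_lt_mul_right this (by linarith)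
  have h6 : (n : ℝ) ≤ Real.exp 40 := by
    rw [← Real.log_le_iff_le_exp hn0]; exact hlt.le
  have h7 : c ^ 2 * n ≤ Real.exp (-21) ^ 2 * Real.exp 40 := by gcongr
  rw [← Real.exp_nat_mul, ← Real.exp_add] at h7
  have h8 : Real.exp (-2) ≤ 1 / 4 := by
    rw [Real.exp_neg, inv_eq_one_div]
    apply one_div_le_one_div_of_le (by norm_num)
    have : Real.exp 2 = Real.exp 1 * Real.exp 1 := by rw [← Real.exp_add]; norm_num
    nlinarith [Real.add_one_le_exp (1 : ℝ)]
  norm_num at h7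
  linarith

theorem steps_le {n : ℕ} (hL : 40 ≤ Real.log n) : (steps n : ℝ) ≤ Real.log n / 8 + 1 := by
  have h2 : 2 ≤ Real.log (Real.log n) := by
    rw [Real.le_log_iff_exp_le (by linarith)]
    have : Real.exp 2 = Real.exp 1 * Real.exp 1 := by rw [← Real.exp_add]; norm_num
    nlinarith [Real.exp_one_lt_d9, Real.exp_pos 1]
  have h3 : (steps n : ℝ) < Real.log n / (4 * Real.log (Real.log n)) + 1 :=
    Nat.ceil_lt_add_one (by positivity)
  have h4 : Real.log n / (4 * Real.log (Real.log n)) ≤ Real.log n / 8 := by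
    gcongr; linarith
  linarith

theorem closeFactor_succ (n k : ℕ) : closeFactor n (k + 1)
    = closeFactor n k * (1 + 1 / Real.log n) + 1 / Real.log n := by
  unfold closeFactor; ring

theorem closeFactor_nonneg {n : ℕ} (hL : 0 ≤ Real.log n) (k : ℕ) : 0 ≤ closeFactor n k := by
  have : 1 ≤ (1 + 1 / Real.log n) ^ k := one_le_pow₀ (by linarith [one_div_nonneg.2 hL])
  unfold closeFactor; linarith

/-- The number of updates is at most `L/4 + 2` with `L = log n ≥ 40`, so `(1 + 1/L)^k ≤ e^(3/10) ≤
3/2`. -/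
theorem closeFactor_le_half {n k : ℕ} (hL : 40 ≤ Real.log n) (hk : k ≤ 2 * steps n) :
    closeFactor n k ≤ 1 / 2 := by
  have h1 : (1 + 1 / Real.log n) ^ k ≤ Real.exp (1 / Real.log n) ^ k := by
    gcongr
    linarith [Real.add_one_le_exp (1 / Real.log n)]
  rw [← Real.exp_nat_mul] at h1
  have hT := steps_le hL
  have hk' : (k : ℝ) ≤ 2 * steps n := by exact_mod_cast hk
  have h2 : (k : ℝ) * (1 / Real.log n) ≤ 3 / 10 := by
    rw [mul_one_div, div_le_iff₀ (by linarith)]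
    linarith
  have h3 := Real.exp_le_exp.2 h2
  have h4 : Real.exp (3 / 10) ≤ 3 / 2 := by
    have h5 := Real.add_one_le_exp (-(3 / 10) : ℝ)
    have h6 : Real.exp (3 / 10) * Real.exp (-(3 / 10)) = 1 := by
      rw [← Real.exp_add]; norm_num
    nlinarith [Real.exp_pos (3 / 10)]
  unfold closeFactor
  linarith

/-- The squared level is at most `2L/m` with `L = log n`, and `m ≥ 16 L⁴ n / c²` makes this at most
`(c/L)² / (8nL)`. That is half of `(c/L)²` times the square of the initial lower bound. -/
theorem level_le {n₁ n m : ℕ} {α c : ℝ} (hc : 0 < c) (hL : 40 ≤ Real.log n)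
    (hm : ((c / (4 * Real.log n)) ^ 2)⁻¹ * ((n₁ : ℝ) + n) * Real.log n ^ 2 ≤ m)
    (hT : 0 < steps n) (hα : 1 / (2 * Real.sqrt (n * Real.log n)) ≤ α) :
    level n m ≤ c / Real.log n * α := by
  have hn0 : (0 : ℝ) < n := by
    rcases Nat.eq_zero_or_pos n with h | h
    · subst h; norm_num at hL
    · exact_mod_cast h
  set L := Real.log n with hLdef
  have hL0 : 0 < L := by linarith
  have hα0 : 0 ≤ α := le_trans (by positivity) hα
  have hT' : (1 : ℝ) ≤ steps n := by exact_mod_cast hT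
  have hlog : Real.log (steps n) ≤ L := by
    have := Real.log_le_sub_one_of_pos (by linarith : (0 : ℝ) < steps n)
    linarith [steps_le hL]
  have hm2 : 16 * L ^ 4 * n / c ^ 2 ≤ m := by
    refine le_trans ?_ hm
    rw [div_pow, inv_div, mul_pow]
    calc 16 * L ^ 4 * n / c ^ 2 = 4 ^ 2 * L ^ 2 / c ^ 2 * (0 + n) * L ^ 2 := by ring
      _ ≤ _ := by gcongr; positivity
  have hm0 : (0 : ℝ) < m := lt_of_lt_of_le (by positivity) hm2
  rw [level]
  apply Real.sqrt_le_iff.2 ⟨by positivity, ?_⟩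
  have h1 : (Real.log (steps n) + L) / m ≤ 2 * L / (16 * L ^ 4 * n / c ^ 2) := by
    gcongr; linarith
  refine h1.trans ?_
  have h2 : 1 / (4 * (n * L)) ≤ α ^ 2 := by
    calc 1 / (4 * (n * L)) = (1 / (2 * Real.sqrt (n * L))) ^ 2 := by
          rw [div_pow, mul_pow, Real.sq_sqrt (by positivity)]; norm_num
      _ ≤ _ := by gcongr
  rw [mul_pow]
  calc 2 * L / (16 * L ^ 4 * n / c ^ 2) = 1 / 2 * ((c / L) ^ 2 * (1 / (4 * (n * L)))) := by
        field_simp; ring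
    _ ≤ 1 * ((c / L) ^ 2 * (1 / (4 * (n * L)))) := by gcongr; norm_num
    _ ≤ _ := by rw [one_mul]; gcongr

/-- Growth by a factor `5 log n` per update over `steps n` full steps leads from the initial
correlation to the end of the first phase. -/
theorem le_growth {n : ℕ} {α c : ℝ} (hn : 3 ≤ n) (hc : c ≤ 1 / 4)
    (hα : 1 / (2 * Real.sqrt (n * Real.log n)) ≤ α) :
    c / Real.log n ≤ (5 * Real.log n) ^ (2 * (steps n - 1) + 1) * α := by
  have hL := one_lt_log hn
  have hn0 : (0 : ℝ) < n := by exact_mod_cast (by omega : 0 < n)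
  have hT := steps_pos hn
  have hle := le_steps n
  obtain ⟨t, ht⟩ : ∃ t, steps n = t + 1 := ⟨steps n - 1, by omega⟩
  rw [ht] at hle ⊢
  rw [Nat.add_sub_cancel]
  set L := Real.log n with hLdef
  have hL0 : 0 < L := by linarith
  have hll := Real.log_pos hL
  have hsL : 0 < Real.sqrt L := Real.sqrt_pos.2 hL0
  have hsn : 0 < Real.sqrt n := Real.sqrt_pos.2 hn0
  rw [div_le_iff₀ (by positivity)] at hle
  have h1 : Real.sqrt n ≤ L ^ (2 * (t + 1)) := by
    rw [Real.sqrt_le_iff]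
    refine ⟨by positivity, ?_⟩
    have : L ^ (2 * (t + 1)) = Real.exp ((2 * (t + 1) : ℕ) * Real.log L) := by
      rw [Real.exp_nat_mul, Real.exp_log hL0]
    rw [this, ← Real.exp_nat_mul, ← Real.log_le_iff_le_exp hn0]
    push_cast at hle ⊢
    linarith
  -- The powers of `L` only compensate `√n`; the powers of `5` absorb the `√L` in the
  -- initialization. With `T = t + 1`, `log L ≤ 2√L` yields `√L ≤ 8T`, and Bernoulli gives `4T ≤
  -- 5^T`.
  have h2 : Real.sqrt L / 2 ≤ 5 ^ (2 * t + 1) := by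
    have h3 : 1 + ((t + 1 : ℕ) : ℝ) * 4 ≤ (1 + 4) ^ (t + 1) :=
      one_add_mul_le_pow (by norm_num) _
    have h4 : (5 : ℝ) ^ (t + 1) ≤ 5 ^ (2 * t + 1) :=
      pow_le_pow_right₀ (by norm_num) (by omega)
    have h5 : Real.log L ≤ 2 * Real.sqrt L := by
      have h6 := Real.log_le_sub_one_of_pos hsL
      rw [Real.log_sqrt hL0.le] at h6
      linarith
    have h7 : Real.sqrt L * Real.sqrt L ≤ ((t + 1 : ℕ) : ℝ) * (4 * (2 * Real.sqrt L)) := by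
      rw [Real.mul_self_sqrt hL0.le]
      exact hle.trans (by gcongr)
    have h8 : Real.sqrt L ≤ ((t + 1 : ℕ) : ℝ) * 8 := by
      refine le_of_mul_le_mul_right (h7.trans (le_of_eq ?_)) hsL
      ring
    norm_num at h3 h8 ⊢
    linarith
  have h9 : (5 * L) ^ (2 * t + 1) * (1 / (2 * Real.sqrt (n * L)))
      ≤ (5 * L) ^ (2 * t + 1) * α := by gcongr
  refine le_trans ?_ h9
  -- The target `c/L` supplies the one power of `L` that the exponent `2t + 1` lacks.
  rw [Real.sqrt_mul hn0.le, div_le_iff₀ hL0]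
  calc c ≤ 1 / 4 := hc
    _ = Real.sqrt L / 2 * Real.sqrt n * (1 / (2 * (Real.sqrt n * Real.sqrt L))) := by
      field_simp; norm_num
    _ ≤ 5 ^ (2 * t + 1) * L ^ (2 * (t + 1)) * (1 / (2 * (Real.sqrt n * Real.sqrt L))) := by
      gcongr
    _ = _ := by rw [mul_pow]; ring

/-! ### The first phase: one update, and the induction over all of them. -/

theorem measOp_transpose_outer (A : Fin m → Mat a b) (x : Vec a) (y : Vec b) :
    measOp (fun i => (A i).transpose) (outer y x) = measOp A (outer x y) := by
  rw [measOp_transpose, outer_transpose]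

theorem par_sub_par {n : ℕ} {e : Vec n} (he : ‖e‖ = 1) (x x' : Vec n) :
    ‖par e x - par e x'‖ = |(inner ℝ e x : ℝ) - inner ℝ e x'| := by
  rw [par, par, ← sub_smul, norm_smul, he, mul_one, Real.norm_eq_abs]

/-- One update during the first phase. -/
theorem Close.update_phase_one {A B : Fin m → Mat a b} {c K L κ r : ℝ} (hc : 0 < c) (hK : 0 ≤ K)
    (hcK : c * (1 + K) ≤ 1 / 1000) (hL : 1 ≤ L) (hA : RIP A (c / (4 * L)))
    (hB : RIP B (c / (4 * L))) {uS uh uhaux : Vec a} {vS v vaux : Vec b} (hu : ‖uS‖ = 1)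
    (hvS : ‖vS‖ = 1) (hAB : ∀ i, diagPart uS vS (B i) = diagPart uS vS (A i))
    (hcl : Close vS v vaux κ)
    (h : ∀ x : Vec a, ‖measOp A (outer uS vS) - measOp A (outer uh v)‖ ^ 2
      ≤ ‖measOp A (outer uS vS) - measOp A (outer x v)‖ ^ 2)
    (haux : ∀ x : Vec a, ‖measOp A (outer uS vS) - measOp B (outer uhaux vaux)‖ ^ 2
      ≤ ‖measOp A (outer uS vS) - measOp B (outer x vaux)‖ ^ 2)
    (hub : UpdateBounds (K * r) uS vS A B v vaux uh uhaux)
    (hκ : 0 ≤ κ) (hκ' : κ ≤ 1 / 2) (hα : |(inner ℝ vS v : ℝ)| < c / L)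
    (hα0 : (inner ℝ vS v : ℝ) ≠ 0) (hr0 : 0 ≤ r) (hr : r ≤ c / L * |(inner ℝ vS v : ℝ)|) :
    Close uS (‖uh‖⁻¹ • uh) (‖uhaux‖⁻¹ • uhaux) (κ * (1 + 1 / L) + 1 / L) ∧
      5 * L * |(inner ℝ vS v : ℝ)| ≤ |(inner ℝ uS (‖uh‖⁻¹ • uh) : ℝ)| := by
  have hL0 : 0 < L := by linarith
  have hcK0 : 0 ≤ c * K := by positivity
  have hc1 : c ≤ 1 / 1000 := by linarith
  have hcL : c / L ≤ 1 / 1000 := by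
    rw [div_le_iff₀ hL0]; linarith
  have hδ : c / (4 * L) = c / L / 4 := by field_simp
  have hδ0 : 0 < c / L := by positivity
  -- The closeness loss per update is at most `1/L` because `1000c + 150cK ≤ 1000c(1 + K) ≤ 1`.
  have hση : 50 * (80 * (c / (4 * L)) + 3 * (K * (c / L))) ≤ 1 / L := by
    rw [show 50 * (80 * (c / (4 * L)) + 3 * (K * (c / L))) = (1000 * c + 150 * (c * K)) / L by
      field_simp; ring]
    gcongr
    linarith
  obtain ⟨h1, h2⟩ := hcl.update (σ := K * (c / L)) hA hB (by positivity) (by rw [hδ]; linarith)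
    hu hvS hAB h haux hub hκ hκ' (by linarith) hα0 (by positivity)
    (by rw [mul_assoc]; gcongr) (by rw [div_le_one hL0]; exact hL) hση
  refine ⟨h1, ?_⟩
  -- The denominator is at most `3c/L`, so the gain is at least `L/(3c)`, which exceeds `5L` since
  -- `15c ≤ 1`.
  have h3 : 2 * |(inner ℝ vS v : ℝ)| + 3 * (c / (4 * L)) ≤ 3 * (c / L) := by
    rw [hδ]; linarith
  have h4 := h2.trans (mul_le_mul_of_nonneg_left h3 (abs_nonneg _))
  have h5 : L * (c / L) = c := by field_simp
  calc 5 * L * |(inner ℝ vS v : ℝ)|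
      ≤ 5 * L * (|(inner ℝ uS (‖uh‖⁻¹ • uh) : ℝ)| * (3 * (c / L))) := by gcongr
    _ = 15 * (L * (c / L)) * |(inner ℝ uS (‖uh‖⁻¹ • uh) : ℝ)| := by ring
    _ ≤ 1 * |(inner ℝ uS (‖uh‖⁻¹ • uh) : ℝ)| := by
      gcongr; rw [h5]; linarith
    _ = _ := one_mul _

end ALS

theorem proposition2 (K : ℝ) (hK : 0 < K) :
    ∃ c : ℝ, 0 < c ∧
      ∀ (n₁ n₂ m : ℕ), 3 ≤ n₂ →
      ∀ (uS : ALS.Vec n₁) (vS : ALS.Vec n₂), ‖uS‖ = 1 → ‖vS‖ = 1 →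
      ∀ (A Ahat : Fin m → ALS.Mat n₁ n₂) (v₀ : ALS.Vec n₂), ‖v₀‖ = 1 →
      -- the original and the auxiliary iterates
      ∀ (u uh uaux uhaux : ℕ → ALS.Vec n₁) (v vh vaux vhaux : ℕ → ALS.Vec n₂),
        ALS.IsALS A (ALS.measOp A (ALS.outer uS vS)) v₀ u uh v vh →
        ALS.IsALS (ALS.auxMat uS vS A Ahat) (ALS.measOp A (ALS.outer uS vS)) v₀
          uaux uhaux vaux vhaux →
      -- restricted isometry property
        ALS.RIP A (c / (4 * Real.log n₂)) →
        ALS.RIP (ALS.auxMat uS vS A Ahat) (c / (4 * Real.log n₂)) →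
      -- number of measurements
        ((c / (4 * Real.log n₂)) ^ 2)⁻¹ * ((n₁ : ℝ) + n₂) * Real.log n₂ ^ 2 ≤ (m : ℝ) →
      -- concentration bounds for the updates from `v t` to `u (t + 1)`
        ALS.SignalBounds uS vS A (ALS.auxMat uS vS A Ahat) →
        (∀ t < ALS.steps n₂, ALS.UpdateBounds (K * ALS.level n₂ m) uS vS A
          (ALS.auxMat uS vS A Ahat) (v t) (vaux t) (uh t) (uhaux t)) →
      -- the same bounds, with the roles of rows and columns exchanged, for the updates from
      -- `u (t + 1)` to `v (t + 1)`
        ALS.SignalBounds vS uS (fun i => (A i).transpose)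
          (fun i => (ALS.auxMat uS vS A Ahat i).transpose) →
        (∀ t < ALS.steps n₂, ALS.UpdateBounds (K * ALS.level n₂ m) vS uS
          (fun i => (A i).transpose) (fun i => (ALS.auxMat uS vS A Ahat i).transpose)
          (u (t + 1)) (uaux (t + 1)) (vh t) (vhaux t)) →
      -- initialization
        1 / (2 * Real.sqrt (n₂ * Real.log n₂)) ≤ |(inner ℝ v₀ vS : ℝ)| →
      -- growth and closeness until the first phase ends
        (∀ t ≤ ALS.steps n₂,
          (∀ s, 1 ≤ s → s ≤ t → ¬ ALS.PhaseOneEnds c uS vS (u s) (v s)) →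
            (Real.log n₂ ^ (2 * t) * ‖ALS.par vS (v 0)‖ ≤ ‖ALS.par vS (v t)‖ ∧
              Real.log n₂ ^ (2 * t) / (2 * Real.sqrt (n₂ * Real.log n₂)) ≤
                Real.log n₂ ^ (2 * t) * ‖ALS.par vS (v 0)‖) ∧
            max ‖ALS.par vS (v t) - ALS.par vS (vaux t)‖
                ‖ALS.perp vS (v t) - ALS.perp vS (vaux t)‖
              ≤ ALS.closeFactor n₂ (2 * t) * ‖ALS.par vS (v t)‖) ∧
      -- and the first phase ends within the prescribed number of steps
        (∃ t, 1 ≤ t ∧ t ≤ ALS.steps n₂ ∧ ALS.PhaseOneEnds c uS vS (u t) (v t)) := by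
  have hc0 : 0 < Real.exp (-21) / (1 + K) := by positivity
  have hcK : Real.exp (-21) / (1 + K) * (1 + K) ≤ 1 / 1000 := by
    rw [div_mul_cancel₀ _ (by positivity)]; exact ALS.exp_neg_twentyone_le
  have hcexp : Real.exp (-21) / (1 + K) ≤ Real.exp (-21) :=
    div_le_self (Real.exp_pos _).le (by linarith)
  -- The factor `1 + K` absorbs the constant in the deviation bounds; `e⁻²¹` forces `log n₂ ≥ 40`
  -- whenever an update is analysed.
  refine ⟨Real.exp (-21) / (1 + K), hc0, ?_⟩
  generalize Real.exp (-21) / (1 + K) = c at hc0 hcK hcexp ⊢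
  intro n₁ n₂ m hn uS vS hu hv A Ahat v₀ hv₀ u uh uaux uhaux v vh vaux vhaux hals halsaux hA hB
    hm _ hub _ hub' hinit
  have hL1 := ALS.one_lt_log hn
  have hT := ALS.steps_pos hn
  have hAB := ALS.diagPart_auxMat hu hv A Ahat
  generalize ALS.auxMat uS vS A Ahat = B at *
  have hAB' : ∀ i, ALS.diagPart vS uS (B i).transpose = ALS.diagPart vS uS (A i).transpose :=
    fun i => by rw [← ALS.diagPart_transpose, hAB, ALS.diagPart_transpose]
  set L := Real.log n₂ with hLdef
  have hL0 : 0 < L := by linarith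
  have hc1 : c ≤ 1 / 1000 := hcexp.trans ALS.exp_neg_twentyone_le
  have hcL : c / L ≤ 1 / 1000 := by
    rw [div_le_iff₀ hL0]; linarith
  have hcL0 : 0 < c / L := by positivity
  have hδ : c / (4 * L) = c / L / 4 := by field_simp
  have hδ0 : 0 < c / (4 * L) := by positivity
  have hδ1 : c / (4 * L) ≤ 1 / 100 := by rw [hδ]; linarith
  have hv0 : ‖v 0‖ = 1 := by rw [hals.init, hv₀]
  have hinit' : 1 / (2 * Real.sqrt (n₂ * L)) ≤ |(inner ℝ vS (v 0) : ℝ)| := by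
    rw [hals.init, real_inner_comm]; exact hinit
  have hr0 : 0 ≤ ALS.level n₂ m := Real.sqrt_nonneg _
  have htr : ∀ (M : Fin m → ALS.Mat n₁ n₂) (x : ALS.Vec n₁) (y : ALS.Vec n₂),
      ALS.measOp M (ALS.outer x y) = ALS.measOp (fun i => (M i).transpose) (ALS.outer y x) :=
    fun M x y => (ALS.measOp_transpose_outer M x y).symm
  have hright := hals.right_argmin
  have hrightaux := halsaux.right_argmin
  -- After transposition a right update is a left update, so one analysis serves both half-steps.
  simp only [htr] at hright hrightaux
  have ends : ∀ t, c / L ≤ |(inner ℝ vS (v t) : ℝ)| → c / L ≤ |(inner ℝ uS (u t) : ℝ)| →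
      ALS.PhaseOneEnds c uS vS (u t) (v t) := by
    intro t h1 h2
    rw [ALS.PhaseOneEnds, ALS.norm_par hv, ALS.norm_par hu]
    exact le_min h1 h2
  have ends_of_left : ∀ t, ‖u (t + 1)‖ = 1 → c / L ≤ |(inner ℝ uS (u (t + 1)) : ℝ)| →
      ALS.PhaseOneEnds c uS vS (u (t + 1)) (v (t + 1)) := by
    intro t h1 h2
    refine ends _ ?_ h2
    have := (hA.transpose.half_le_abs_inner hδ0 hδ1 hv hu h1 (by rw [hδ]; linarith)
      (hright t)).2
    rw [← hals.right_normalize] at this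
    linarith
  have ends_of_right : ∀ t, ‖v t‖ = 1 → c / L ≤ |(inner ℝ vS (v t) : ℝ)| →
      ALS.PhaseOneEnds c uS vS (u (t + 1)) (v (t + 1)) := by
    intro t h1 h2
    have := hA.half_le_abs_inner hδ0 hδ1 hu hv h1 (by rw [hδ]; linarith) (hals.left_argmin t)
    rw [← hals.left_normalize] at this
    exact ends_of_left t this.1 (by linarith [this.2])
  have hcf0 : ALS.closeFactor n₂ 0 = 0 := by simp [ALS.closeFactor]
  -- The bounds on the left iterates are carried along because termination is read off from `u_T`,
  -- half an update before `v_T`.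
  have invariant : ∀ t ≤ ALS.steps n₂,
      (∀ s, 1 ≤ s → s ≤ t → ¬ ALS.PhaseOneEnds c uS vS (u s) (v s)) →
      ALS.Close vS (v t) (vaux t) (ALS.closeFactor n₂ (2 * t)) ∧
      (5 * L) ^ (2 * t) * |(inner ℝ vS (v 0) : ℝ)| ≤ |(inner ℝ vS (v t) : ℝ)| ∧
      (∀ s < t, (5 * L) ^ (2 * s + 1) * |(inner ℝ vS (v 0) : ℝ)|
        ≤ |(inner ℝ uS (u (s + 1)) : ℝ)|) ∧ (∀ s < t, ‖u (s + 1)‖ = 1) := by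
    intro t
    induction t with
    | zero =>
      intro _ _
      have h00 : v 0 = vaux 0 := by rw [hals.init, halsaux.init]
      refine ⟨⟨hv0, h00 ▸ hv0, ?_, ?_⟩, by simp, by simp, by simp⟩ <;> simp [hcf0, h00]
    | succ t ih =>
      intro htT hne
      obtain ⟨hcl, hgrow, hleft, hunit⟩ :=
        ih (by omega) fun s hs hst => hne s hs (by omega)
      have hend := hne (t + 1) (by omega) le_rfl
      have hone : ∀ k : ℕ, 1 ≤ (5 * L) ^ k := fun k => one_le_pow₀ (by linarith)
      have hge : ∀ {k : ℕ} {z : ℝ}, (5 * L) ^ k * |(inner ℝ vS (v 0) : ℝ)| ≤ z →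
          |(inner ℝ vS (v 0) : ℝ)| ≤ z := fun {k z} h =>
        (le_mul_of_one_le_left (abs_nonneg _) (hone k)).trans h
      -- A larger correlation of `v t` would make both iterates at `t + 1` strongly correlated, by
      -- RIP alone. So the phase not having ended at `t + 1` keeps `v t` small, including `v 0`.
      have hvt : |(inner ℝ vS (v t) : ℝ)| < c / L := by
        by_contra! h
        exact hend (ends_of_right t hcl.norm_left h)
      have hL40 : 40 ≤ Real.log n₂ :=
        ALS.forty_le_log hn hc0 hcexp hinit' ((hge hgrow).trans_lt hvt)
      have hlevel : ALS.level n₂ m ≤ c / L * |(inner ℝ vS (v 0) : ℝ)| :=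
        ALS.level_le hc0 hL40 hm hT hinit'
      have hα0 : 0 < |(inner ℝ vS (v 0) : ℝ)| :=
        lt_of_lt_of_le (by positivity) hinit'
      have hcf := fun k => ALS.closeFactor_nonneg (n := n₂) hL0.le k
      obtain ⟨hclu, hgu⟩ := hcl.update_phase_one hc0 hK.le hcK hL1.le hA hB hu hv hAB
        (hals.left_argmin t) (halsaux.left_argmin t) (hub t (by omega)) (hcf _)
        (ALS.closeFactor_le_half hL40 (by omega)) hvt
        (abs_pos.1 (hα0.trans_le (hge hgrow))) hr0
        (hlevel.trans (mul_le_mul_of_nonneg_left (hge hgrow) hcL0.le))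
      rw [← hals.left_normalize, ← halsaux.left_normalize, ← ALS.closeFactor_succ] at hclu
      rw [← hals.left_normalize] at hgu
      have hgrowu : (5 * L) ^ (2 * t + 1) * |(inner ℝ vS (v 0) : ℝ)|
          ≤ |(inner ℝ uS (u (t + 1)) : ℝ)| := by
        refine le_trans ?_ hgu
        rw [pow_succ', mul_assoc]
        gcongr
      have hut : |(inner ℝ uS (u (t + 1)) : ℝ)| < c / L := by
        by_contra! h
        exact hend (ends_of_left t hclu.norm_left h)
      obtain ⟨hclv, hgv⟩ := hclu.update_phase_one hc0 hK.le hcK hL1.le hA.transpose hB.transpose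
        hv hu hAB' (hright t) (hrightaux t) (hub' t (by omega)) (hcf _)
        (ALS.closeFactor_le_half hL40 (by omega)) hut
        (abs_pos.1 (hα0.trans_le (hge hgrowu))) hr0
        (hlevel.trans (mul_le_mul_of_nonneg_left (hge hgrowu) hcL0.le))
      rw [← hals.right_normalize, ← halsaux.right_normalize, ← ALS.closeFactor_succ] at hclv
      rw [← hals.right_normalize] at hgv
      refine ⟨hclv, ?_, ?_, ?_⟩
      · refine le_trans ?_ hgv
        rw [show 2 * (t + 1) = (2 * t + 1) + 1 by ring, pow_succ', mul_assoc]
        gcongr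
      · intro s hs
        rcases Nat.lt_succ_iff_lt_or_eq.1 hs with h | rfl
        · exact hleft s h
        · exact hgrowu
      · intro s hs
        rcases Nat.lt_succ_iff_lt_or_eq.1 hs with h | rfl
        · exact hunit s h
        · exact hclu.norm_left
  refine ⟨fun t ht hne => ?_, ?_⟩
  · obtain ⟨hcl, hgrow, -, -⟩ := invariant t ht hne
    rw [ALS.norm_par hv, ALS.norm_par hv, ALS.par_sub_par hv]
    refine ⟨⟨le_trans ?_ hgrow, ?_⟩, max_le hcl.inner_sub hcl.perp_sub⟩
    · gcongr; linarith
    · rw [div_eq_mul_one_div]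
      gcongr
  -- If the phase never ended, the invariant would hold up to `T`, and growth would give `u_T`
  -- correlation at least `c/L`. One more right update then ends the phase at step `T`.
  · by_contra! hne
    obtain ⟨-, -, hleft, hunit⟩ := invariant _ le_rfl fun s hs hsT => hne s hs hsT
    have hlast := hleft (ALS.steps n₂ - 1) (by omega)
    refine hne (ALS.steps n₂ - 1 + 1) (by omega) (by omega) (ends_of_left _ (hunit _ (by omega)) ?_)
    exact (ALS.le_growth hn (by linarith) hinit').trans hlast
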